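/- Let $(\mathcal M,\mathfrak g)$ be a smooth Riemannian manifold of dimension $d\ge 1$ (Hausdorff, second countable) whose exponential map $\mathrm{Exp}_x$ is defined on all of $T_x\mathcal M$ for every $x$ (geodesic completeness). Let $n\ge1$, $f_1,\dots,f_n:\mathcal M\to\mathbb R$ and $f=\frac1n\sum_{i=1}^n f_i$. Assume that each $f_i$ is differentiable and geodesically $L$-smooth with $L>0$: for every geodesic $\gamma$ from $x=\gamma(0)$ to $y=\gamma(1)$, $\|\nabla f_i(x)-\Gamma_y^x\nabla f_i(y)\|\le L\|\gamma'(0)\|$, where $\Gamma_y^x$ is parallel transport along $\gamma$ and $\gamma'(0)=\mathrm{Exp}_x^{-1}(y)$. Assume $f\ge f^*$ on $\mathcal M$ for some $f^*\in\mathbb R$, let $x^0\in\mathcal M$ and $\delta^0=f(x^0)-f^*$. Let $\mathcal Q_1,\dots,\mathcal Q_n$ be (measurable) stochastic maps, each sending $y\in T_x\mathcal M$ to a random vector of $T_x\mathcal M$, with $\mathbb E[\mathcal Q_i(y)]=y$ and $\mathbb E\|\mathcal Q_i(y)-y\|^2\le\omega\|y\|^2$ for all $x\in\mathcal M$, $y\in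 T_x\mathcal M$, where $\omega\ge0$. Fix a (measurable) choice of a basis of every tangent space, let $\|z\|_0$ be the number of nonzero components of $z$ in this basis, and let $\rho_{\mathcal Q}=\sup_{i,x,\,y\in T_x\mathcal M}\mathbb E\|\mathcal Q_i(y)\|_0$ be the expected density. R-MARINA with stepsize $\eta$ and probability $p$ starts from $x^0$ with $g_i^0=\nabla f_i(x^0)$. In each round $k=0,1,\dots,K-1$, with $g^k=\frac1n\sum_i g_i^k$, it sets $x^{k+1}=\mathrm{Exp}_{x^k}(-\eta g^k)$ and flips one coin that is common to all workers; with probability $p$ every worker $i$ sends $\nabla f_i(x^{k+1})$ and $g_i^{k+1}=\nabla f_i(x^{k+1})$; otherwise every worker $i$ sends $\mathcal Q_i(\Delta_i^k)$ with $\Delta_i^k=\nabla f_i(x^{k+1})-\Gamma_{x^k}^{x^{k+1}}\nabla f_i(x^k)$, and $g_i^{k+1}=\Gamma_{x^k}^{x^{k+1}}g_i^k+\mathcal Q_i(\Delta_i^k)$. Here $\Gamma_{x^k}^{x^{k+1}}$ is parallel transport along the geodesic $t\mapsto\mathrm{Exp}_{x^k}(-t\eta g^k)$, and the coins and the randomness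 of the compressors are independent over all rounds and workers. Let $\widehat x^K$ be chosen uniformly at random from $x^0,\dots,x^{K-1}$, independently of the run. The communication cost of a worker is the number of components it sends: $d$ for a full gradient (in particular for $\nabla f_i(x^0)$ at the start), and $\|\mathcal Q_i(\Delta_i^k)\|_0$ for a compressed difference. Take $p=\rho_{\mathcal Q}/d$ and $\eta=\dfrac{1}{L\left(1+\sqrt{\frac{1-p}{p}\frac{\omega}{n}}\right)}$. Then there is an absolute constant $C>0$ (independent of all the data above) such that, for every $\varepsilon>0$: 1. there is an integer $K_0\ge1$ with $$K_0\le\max\left\{1,\;C\,\frac{\delta^0L}{\varepsilon^2}\left(1+\sqrt{\frac{\omega}{n}\left(\frac{d}{\rho_{\mathcal Q}}-1\right)}\right)\right\}$$ such that $\mathbb E\|\nabla f(\widehat x^K)\|^2\le\varepsilon^2$ for all $K\ge K_0$; that is, the communication complexity is $\mathcal O\left(\frac{\delta^0L}{\varepsilon^2}\left(1+\sqrt{\frac{\omega}{n}\left(\frac{d}{\rho_{\mathcal Q}}-1\right)}\right)\right)$; 2. for every $K$ and every worker, the expected total communication cost of $K$ rounds is at most $C(d+\rho_{\mathcal Q}K)$.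 -/

import Mathlib

open Bundle Manifold MeasureTheory ProbabilityTheory
open scoped ContDiff ENNReal Manifold

noncomputable section

namespace RMarina

section Geometry

variable {d : ℕ} {M : Type*} [TopologicalSpace M]
  [ChartedSpace (EuclideanSpace ℝ (Fin d)) M] [IsManifold (𝓡 d) ∞ M]

/-- The velocity `γ'(t)` of a curve in `M`. -/
def velocity (γ : ℝ → M) (t : ℝ) : TangentSpace (𝓡 d) (γ t) :=
  mfderiv 𝓘(ℝ, ℝ) (𝓡 d) γ t (1 : ℝ)

/-- The coordinates `dφ_q(v)` of a tangent vector `v` at `q`, for the chart `φ` around `p` (`q` in its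
domain). -/
def toCoord (p q : M) (v : TangentSpace (𝓡 d) q) : EuclideanSpace ℝ (Fin d) :=
  (trivializationAt (EuclideanSpace ℝ (Fin d)) (TangentSpace (𝓡 d) : M → Type _) p).continuousLinearMapAt
    ℝ q v

/-- The tangent vector at `q` with coordinates `u` in the chart around `p`, the inverse of
`toCoord`. -/
def ofCoord (p q : M) (u : EuclideanSpace ℝ (Fin d)) : TangentSpace (𝓡 d) q :=
  (trivializationAt (EuclideanSpace ℝ (Fin d)) (TangentSpace (𝓡 d) : M → Type _) p).symmL ℝ q u

variable [RiemannianBundle (fun x : M => TangentSpace (𝓡 d) x)]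

/-- The Riemannian metric in the chart `φ` around `p`: `G(y)(u, w)` is the inner product of the tangent
vectors at `φ⁻¹(y)` with coordinates `u` and `w`. -/
def chartMetric (p : M) (y u w : EuclideanSpace ℝ (Fin d)) : ℝ :=
  inner ℝ (ofCoord p ((extChartAt (𝓡 d) p).symm y) u) (ofCoord p ((extChartAt (𝓡 d) p).symm y) w)

/-- The Christoffel symbols of the first kind of the Levi-Civita connection in the chart around `p`,
that is `G(∇_u w, z)` for constant coordinate fields `u`, `w`, `z`. -/
def christoffel (p : M) (y u w z : EuclideanSpace ℝ (Fin d)) : ℝ :=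
  (fderiv ℝ (fun y' => chartMetric p y' w z) y u
    + fderiv ℝ (fun y' => chartMetric p y' u z) y w
    - fderiv ℝ (fun y' => chartMetric p y' u w) y z) / 2

/-- The vector field `V` along the curve `γ` is parallel for the Levi-Civita connection: at each time
`t`, in the chart `φ` around `γ t`, with `c = φ ∘ γ` and `v = dφ(V)`, the covariant derivative
`v' + Γ(c', v)` vanishes. The equation is written with the index lowered by the metric, i.e. tested
against every `z`. -/
def IsParallelAlong (γ : ℝ → M) (V : ∀ t, TangentSpace (𝓡 d) (γ t)) : Prop :=
  ∀ t, MDifferentiableAt 𝓘(ℝ, ℝ) (𝓡 d) γ t ∧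
    ∃ v' : EuclideanSpace ℝ (Fin d),
      HasDerivAt (fun s => toCoord (γ t) (γ s) (V s)) v' t ∧
      ∀ z : EuclideanSpace ℝ (Fin d),
        chartMetric (γ t) (extChartAt (𝓡 d) (γ t) (γ t)) v' z
          + christoffel (γ t) (extChartAt (𝓡 d) (γ t) (γ t))
              (deriv (fun s => extChartAt (𝓡 d) (γ t) (γ s)) t)
              (toCoord (γ t) (γ t) (V t)) z = 0

/-- Geodesics: the velocity is parallel along the curve. -/
def IsGeodesic (γ : ℝ → M) : Prop :=
  IsParallelAlong (d := d) γ (velocity γ)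

variable (d M) in
/-- Every tangent vector is the initial velocity of a geodesic defined for all times, i.e. the
exponential map is defined on the whole tangent bundle. -/
def GeodesicallyComplete : Prop :=
  ∀ (x : M) (v : TangentSpace (𝓡 d) x), ∃ γ : ℝ → M, IsGeodesic (d := d) γ ∧
    (⟨γ 0, velocity γ 0⟩ : TangentBundle (𝓡 d) M) = ⟨x, v⟩

open Classical in
/-- The geodesic `t ↦ Exp_x(t v)` (the constant curve if there is none). -/
def geodesic (x : M) (v : TangentSpace (𝓡 d) x) : ℝ → M :=
  if h : ∃ γ : ℝ → M, IsGeodesic (d := d) γ ∧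
      (⟨γ 0, velocity γ 0⟩ : TangentBundle (𝓡 d) M) = ⟨x, v⟩
  then h.choose else fun _ => x

/-- The exponential map `Exp_x(v)`. -/
def riemExp (x : M) (v : TangentSpace (𝓡 d) x) : M := geodesic x v 1

open Classical in
/-- Parallel transport along `γ` from time `a` to time `b` of the tangent vector `u` at `γ a`. -/
def parallelTransport (γ : ℝ → M) (a b : ℝ) (u : TangentBundle (𝓡 d) M) :
    TangentSpace (𝓡 d) (γ b) :=
  if h : ∃ V : ∀ t, TangentSpace (𝓡 d) (γ t), IsParallelAlong γ V ∧
      (⟨γ a, V a⟩ : TangentBundle (𝓡 d) M) = u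
  then h.choose b else 0

/-- Parallel transport `T_x M → T_y M`, `y = Exp_x(v)`, along the geodesic `t ↦ Exp_x(t v)`. -/
def expTransport (x : M) (v u : TangentSpace (𝓡 d) x) : TangentSpace (𝓡 d) (riemExp x v) :=
  parallelTransport (geodesic x v) 0 1 ⟨x, u⟩

/-- The Riemannian gradient of `f` at `x`: the tangent vector representing `df(x)`. -/
def riemGrad (f : M → ℝ) (x : M) : TangentSpace (𝓡 d) x :=
  haveI : FiniteDimensional ℝ (TangentSpace (𝓡 d) x) :=
    inferInstanceAs (FiniteDimensional ℝ (EuclideanSpace ℝ (Fin d)))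
  haveI : CompleteSpace (TangentSpace (𝓡 d) x) :=
    FiniteDimensional.complete ℝ (TangentSpace (𝓡 d) x)
  (InnerProductSpace.toDual ℝ (TangentSpace (𝓡 d) x)).symm (mvfderiv (𝓡 d) f x)

variable (d) in
/-- Geodesic `L`-smoothness: `f` is differentiable and, for every geodesic `γ` from `x = γ 0` to
`y = γ 1`, `‖∇f(x) - Γ_y^x ∇f(y)‖ ≤ L ‖γ'(0)‖`, where `Γ_y^x` is the parallel transport along `γ`
and `γ'(0) = Exp_x⁻¹(y)`. -/
def IsGSmooth (L : ℝ) (f : M → ℝ) : Prop :=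
  MDifferentiable (𝓡 d) 𝓘(ℝ, ℝ) f ∧
  ∀ γ : ℝ → M, IsGeodesic (d := d) γ →
    ‖riemGrad (d := d) f (γ 0)
        - parallelTransport γ 1 0 ⟨γ 1, riemGrad (d := d) f (γ 1)⟩‖
      ≤ L * ‖velocity (d := d) γ 0‖

end Geometry

section Compression

variable {d : ℕ} {M : Type*} [TopologicalSpace M]
  [ChartedSpace (EuclideanSpace ℝ (Fin d)) M] [IsManifold (𝓡 d) ∞ M]
  {S : Type*} [MeasurableSpace S]

variable (d) in
/-- A Borel measurable frame of the tangent bundle: a basis of every tangent space. The components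
of a tangent vector are its coordinates in this basis. -/
structure MeasurableFrame (M : Type*) [TopologicalSpace M]
    [ChartedSpace (EuclideanSpace ℝ (Fin d)) M] [IsManifold (𝓡 d) ∞ M] where
  basis : ∀ x : M, Module.Basis (Fin d) ℝ (TangentSpace (𝓡 d) x)
  measurable : ∀ j : Fin d, @Measurable M (TangentBundle (𝓡 d) M) (borel _) (borel _)
    (fun x => ⟨x, basis x j⟩)

/-- `‖z‖₀`, the number of nonzero components of `z`. -/
def MeasurableFrame.nnz (b : MeasurableFrame d M) {x : M} (z : TangentSpace (𝓡 d) x) : ℕ :=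
  ((b.basis x).repr z).support.card

/-- `q s x y` is the value on `y ∈ T_x M` of a stochastic map with random seed `s ∼ ν`. It is an
unbiased compressor with conic variance `ωQ`. -/
structure IsUnbiasedCompressor [RiemannianBundle (fun x : M => TangentSpace (𝓡 d) x)]
    (ν : Measure S) (ωQ : ℝ)
    (q : S → ∀ x : M, TangentSpace (𝓡 d) x → TangentSpace (𝓡 d) x) : Prop where
  nonneg : 0 ≤ ωQ
  measurable : @Measurable (S × TangentBundle (𝓡 d) M) (TangentBundle (𝓡 d) M)
    (@Prod.instMeasurableSpace _ _ _ (borel _)) (borel _)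
    (fun z => ⟨z.2.proj, q z.1 z.2.proj z.2.snd⟩)
  unbiased : ∀ (x : M) (y : TangentSpace (𝓡 d) x), ∫ s, q s x y ∂ν = y
  variance : ∀ (x : M) (y : TangentSpace (𝓡 d) x),
    ∫⁻ s, ‖q s x y - y‖ₑ ^ 2 ∂ν ≤ ENNReal.ofReal (ωQ * ‖y‖ ^ 2)

/-- The expected density `ρ_Q`: the supremum of `𝔼 ‖Q_i(y)‖₀` over all workers `i`, points `x` and
`y ∈ T_x M`. -/
def expectedDensity {n : ℕ} (b : MeasurableFrame d M) (ν : Measure S)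
    (Q : Fin n → S → ∀ x : M, TangentSpace (𝓡 d) x → TangentSpace (𝓡 d) x) : ℝ :=
  (⨆ (i : Fin n) (x : M) (y : TangentSpace (𝓡 d) x),
    ∫⁻ s, (b.nnz (Q i s x y) : ℝ≥0∞) ∂ν).toReal

end Compression

section Algorithm

variable {d : ℕ} {M : Type*} [TopologicalSpace M]
  [ChartedSpace (EuclideanSpace ℝ (Fin d)) M] [IsManifold (𝓡 d) ∞ M]
  [RiemannianBundle (fun x : M => TangentSpace (𝓡 d) x)]
  {S : Type*} [MeasurableSpace S] {n : ℕ}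

/-- The objective `f = (1/n) ∑ f_i`. -/
def objective (f : Fin n → M → ℝ) (x : M) : ℝ := (∑ i, f i x) / n

variable (d M n) in
/-- The state of the method: the iterate `x^k` and the estimators `g_i^k` of the workers. -/
structure State where
  point : M
  est : Fin n → TangentSpace (𝓡 d) point

/-- The step vector `-η g^k` with `g^k = (1/n) ∑ g_i^k`. -/
def State.stepVec (η : ℝ) (st : State d M n) : TangentSpace (𝓡 d) st.point :=
  -(η • ((n : ℝ)⁻¹ • ∑ i, st.est i))

/-- The next iterate `x^{k+1} = Exp_{x^k}(-η g^k)`. -/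
def State.next (η : ℝ) (st : State d M n) : M := riemExp st.point (st.stepVec η)

/-- The parallel transport `Γ_{x^k}^{x^{k+1}}` along the geodesic of the step. -/
def State.transport (η : ℝ) (st : State d M n) (u : TangentSpace (𝓡 d) st.point) :
    TangentSpace (𝓡 d) (st.next η) :=
  expTransport st.point (st.stepVec η) u

/-- The gradient difference `∇f_i(x^{k+1}) - Γ_{x^k}^{x^{k+1}} ∇f_i(x^k)` of worker `i`. -/
def State.gradDiff (f : Fin n → M → ℝ) (η : ℝ) (st : State d M n) (i : Fin n) :
    TangentSpace (𝓡 d) (st.next η) :=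
  riemGrad (f i) (st.next η) - st.transport η (riemGrad (f i) st.point)

/-- The randomness of one round: the coin shared by all workers (`true` means that the full gradients
are sent) and the seeds of the compressors of the workers. -/
abbrev Round (S : Type*) (n : ℕ) := Bool × (Fin n → S)

/-- One round of R-MARINA. -/
def step (f : Fin n → M → ℝ)
    (Q : Fin n → S → ∀ x : M, TangentSpace (𝓡 d) x → TangentSpace (𝓡 d) x)
    (η : ℝ) (st : State d M n) (r : Round S n) : State d M n where
  point := st.next η
  est i :=
    if r.1 then riemGrad (f i) (st.next η)
    else st.transport η (st.est i) + Q i (r.2 i) (st.next η) (st.gradDiff f η i)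

/-- The state after `k` rounds, started at `x⁰` with `g_i^0 = ∇f_i(x⁰)`. -/
def iter (f : Fin n → M → ℝ)
    (Q : Fin n → S → ∀ x : M, TangentSpace (𝓡 d) x → TangentSpace (𝓡 d) x)
    (η : ℝ) (x0 : M) : (k : ℕ) → (Fin k → Round S n) → State d M n
  | 0, _ => ⟨x0, fun i => riemGrad (f i) x0⟩
  | k + 1, r => step f Q η (iter f Q η x0 k (Fin.init r)) (r (Fin.last k))

/-- The state `(x^k, g_i^k)` in a run of `K` rounds with randomness `r`, for `k ≤ K`. -/
def iterOf (f : Fin n → M → ℝ)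
    (Q : Fin n → S → ∀ x : M, TangentSpace (𝓡 d) x → TangentSpace (𝓡 d) x)
    (η : ℝ) (x0 : M) {K : ℕ} (r : Fin K → Round S n) (k : Fin (K + 1)) : State d M n :=
  iter f Q η x0 k (fun j => r (Fin.castLE k.is_le j))

/-- The law of the randomness of a run of `K` rounds: all coins are Bernoulli(`p`), all seeds have
law `ν`, and all of them are independent. -/
def runLaw (p : unitInterval) (ν : Measure S) (n K : ℕ) : Measure (Fin K → Round S n) :=
  Measure.pi fun _ => (bernoulliMeasure true false p).prod (Measure.pi fun _ => ν)

/-- `𝔼 ‖∇f(x̂^K)‖²`, where `x̂^K` is chosen from `x⁰, …, x^{K-1}` uniformly at random and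
independently of the run. -/
def expectedSqGrad (f : Fin n → M → ℝ)
    (Q : Fin n → S → ∀ x : M, TangentSpace (𝓡 d) x → TangentSpace (𝓡 d) x)
    (η : ℝ) (x0 : M) (p : unitInterval) (ν : Measure S) (K : ℕ) : ℝ≥0∞ :=
  ∫⁻ z, ‖riemGrad (d := d) (objective f) (iterOf f Q η x0 z.1 z.2.castSucc).point‖ₑ ^ 2
    ∂((runLaw p ν n K).prod (uniformOn (Set.univ : Set (Fin K))))

/-- The number of components that worker `i` sends in a run of `K` rounds: the `d` components of
`∇f_i(x⁰)`, and in each round either the `d` components of `∇f_i(x^{k+1})` or the nonzero components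
of the compressed gradient difference. -/
def commCost (b : MeasurableFrame d M) (f : Fin n → M → ℝ)
    (Q : Fin n → S → ∀ x : M, TangentSpace (𝓡 d) x → TangentSpace (𝓡 d) x)
    (η : ℝ) (x0 : M) (i : Fin n) {K : ℕ} (r : Fin K → Round S n) : ℕ :=
  d + ∑ k : Fin K,
    if (r k).1 then d
    else b.nnz (Q i ((r k).2 i) _ ((iterOf f Q η x0 r k.castSucc).gradDiff f η i))

end Algorithm

end RMarina

end

/-!
Parallel transport solves a linear differential equation that is compatible with the metric, so it
is a linear isometry, and geodesic `L`-smoothness of `f_i` yields both the quadratic upper bound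
`f_i (Exp_x v) ≤ f_i x + ⟨∇f_i x, v⟩ + L ‖v‖² / 2` and
`‖∇f_i (Exp_x v) - Γ ∇f_i x‖ ≤ L ‖v‖`.

Let `e^k = g^k - ∇f(x^k)`. A coin that shows a full gradient resets `e^k` to `0`; otherwise
`e^{k+1}` is `Γ e^k` plus the average of the `n` independent centred errors of the compressors,
whose second moment is at most `ω L² η² ‖g^k‖² / n`. With the bound on `f`, the potential
`Φ^k = (2 / η) (f(x^k) - f^*) + ‖e^k‖² / p` satisfies `‖∇f(x^k)‖² + 𝔼 Φ^{k+1} ≤ Φ^k` as soon as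
`L η + (1 - p) / p * ω / n * (L η)² ≤ 1`, which the stepsize guarantees. Summing over the rounds
bounds `𝔼 ‖∇f(x̂^K)‖²` by `2 (f(x⁰) - f^*) / (η K)`.

The state of a run need not be a measurable function of its randomness. All the bounds are therefore
stated for lower integrals, which are at most the corresponding iterated integrals.
-/

noncomputable section

namespace RMarina

open scoped Topology

section Gluing

variable {α : Type*} [ConditionallyCompleteLinearOrder α] [TopologicalSpace α] [OrderTopology α]
  [DenselyOrdered α] {β : α → Type*}

/-- A condition on sections `V` of `β` that is local, such as a differential equation of first
order, whose solutions on an interval are determined by one value. -/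
structure IsUniqueLocalCondition (P : (∀ t, β t) → α → Prop) : Prop where
  congr : ∀ {V W : ∀ t, β t} {t : α}, P V t → (∀ᶠ s in 𝓝 t, W s = V s) → P W t
  unique : ∀ {V W : ∀ t, β t} {U : Set α}, IsOpen U → U.OrdConnected → (∀ t ∈ U, P V t) →
    (∀ t ∈ U, P W t) → ∀ {s}, s ∈ U → V s = W s → ∀ {t}, t ∈ U → V t = W t

/-- Every initial value at `s` has a solution on an open interval that contains `s` and `t`. -/
def SolvableBetween (P : (∀ t, β t) → α → Prop) (s t : α) : Prop :=
  ∀ u : β s, ∃ V, V s = u ∧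
    ∃ U : Set α, IsOpen U ∧ U.OrdConnected ∧ s ∈ U ∧ t ∈ U ∧ ∀ r ∈ U, P V r

variable {P : (∀ t, β t) → α → Prop}

open Classical in
lemma SolvableBetween.trans (hP : IsUniqueLocalCondition P) {s t r : α}
    (hst : SolvableBetween P s t) (htr : SolvableBetween P t r) : SolvableBetween P s r := by
  intro u
  obtain ⟨V, hVs, U, hU, hU', hsU, htU, hV⟩ := hst u
  obtain ⟨W, hWt, U', hO, hO', htO, hrO, hW⟩ := htr (V t)
  have hVW : ∀ q ∈ U, q ∈ U' → V q = W q := fun q hq hq' =>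
    hP.unique (hU.inter hO) (hU'.inter hO') (fun q hq => hV q hq.1) (fun q hq => hW q hq.2)
      ⟨htU, htO⟩ hWt.symm ⟨hq, hq'⟩
  refine ⟨fun q => if q ∈ U then V q else W q, by simp only [hsU, if_true, hVs], U ∪ U',
    hU.union hO, isPreconnected_iff_ordConnected.1
      (hU'.isPreconnected.union t htU htO hO'.isPreconnected), .inl hsU, .inr hrO, ?_⟩
  rintro q (hq | hq)
  · refine hP.congr (hV q hq) ?_
    filter_upwards [hU.mem_nhds hq] with s hs using if_pos hs
  · refine hP.congr (hW q hq) ?_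
    filter_upwards [hO.mem_nhds hq] with s hs
    split_ifs with h
    exacts [hVW s h hs, rfl]

variable [NoMinOrder α] [NoMaxOrder α]

lemma IsUniqueLocalCondition.solvableBetween (hP : IsUniqueLocalCondition P)
    (hloc : ∀ t₀, ∃ U ∈ 𝓝 t₀, ∀ t₁ ∈ U, ∀ u, ∃ V, V t₁ = u ∧ ∀ t ∈ U, P V t) (s t : α) :
    SolvableBetween P s t := by
  refine PreconnectedSpace.induction₂' (SolvableBetween P) (fun t₀ => ?_)
    ⟨fun _ _ _ => SolvableBetween.trans hP⟩ s t
  obtain ⟨U, hU, hsol⟩ := hloc t₀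
  obtain ⟨l, r, ht₀, hlr⟩ := mem_nhds_iff_exists_Ioo_subset.1 hU
  have key : ∀ {t₁ t₂}, t₁ ∈ Set.Ioo l r → t₂ ∈ Set.Ioo l r → SolvableBetween P t₁ t₂ := by
    intro t₁ t₂ h₁ h₂ u
    obtain ⟨V, hV, hPV⟩ := hsol t₁ (hlr h₁) u
    exact ⟨V, hV, _, isOpen_Ioo, Set.ordConnected_Ioo, h₁, h₂, fun q hq => hPV q (hlr hq)⟩
  filter_upwards [isOpen_Ioo.mem_nhds ht₀] with t₁ ht₁ using ⟨key ht₀ ht₁, key ht₁ ht₀⟩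

theorem IsUniqueLocalCondition.exists_global (hP : IsUniqueLocalCondition P)
    (hloc : ∀ t₀, ∃ U ∈ 𝓝 t₀, ∀ t₁ ∈ U, ∀ u, ∃ V, V t₁ = u ∧ ∀ t ∈ U, P V t) (a : α) (u : β a) :
    ∃ V, V a = u ∧ ∀ t, P V t := by
  choose V hVa U hU hU' haU htU hPV using fun t => hP.solvableBetween hloc a t u
  refine ⟨fun t => V t t, hVa a, fun t => hP.congr (hPV t t (htU t)) ?_⟩
  filter_upwards [(hU t).mem_nhds (htU t)] with s hs
  exact hP.unique ((hU s).inter (hU t)) ((hU' s).inter (hU' t)) (fun q hq => hPV s q hq.1)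
    (fun q hq => hPV t q hq.2) ⟨haU s, haU t⟩ ((hVa s).trans (hVa t).symm) ⟨htU s, hs⟩

end Gluing

section LinearODE

open scoped NNReal

variable {E : Type*} [NormedAddCommGroup E] [NormedSpace ℝ E] {A : ℝ → E →L[ℝ] E} {t₀ : ℝ}

lemma isPicardLindelof_linear {x₀ : E} {a b : ℝ} {t : Set.Icc a b} {K : ℝ≥0}
    (hA : ContinuousOn A (Set.Icc a b)) (hK : ∀ t ∈ Set.Icc a b, ‖A t‖₊ ≤ K)
    (hab : K * (‖x₀‖ + 1) * max (b - t) (t - a) ≤ 1) :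
    IsPicardLindelof (fun t x => A t x) t x₀ 1 0 (K * (‖x₀‖₊ + 1)) K where
  lipschitzOnWith t ht := ((A t).lipschitz.weaken (hK t ht)).lipschitzOnWith
  continuousOn x _ := hA.clm_apply continuousOn_const
  norm_le t ht x hx := by
    have hx' : ‖x‖ ≤ ‖x₀‖ + 1 := by
      linarith [norm_le_norm_add_norm_sub' x x₀, mem_closedBall_iff_norm.1 hx,
        NNReal.coe_one]
    exact ((A t).le_opNorm x).trans
      (mul_le_mul (hK t ht) hx' (norm_nonneg x) K.coe_nonneg)
  mul_max_le := by simpa using hab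

variable [CompleteSpace E]

lemma exists_eventually_hasDerivAt_linear (hA : ∀ᶠ s in 𝓝 t₀, ContinuousAt A s) (x₀ : E) :
    ∃ x : ℝ → E, x t₀ = x₀ ∧ ∀ᶠ t in 𝓝 t₀, HasDerivAt x (A t (x t)) t := by
  set K : ℝ≥0 := ‖A t₀‖₊ + 1 with hK
  have hbound : ∀ᶠ s in 𝓝 t₀, ‖A s‖₊ ≤ K :=
    hA.self_of_nhds.nnnorm.eventually_le_const (lt_add_one _)
  obtain ⟨δ, hδ, hball⟩ := Metric.eventually_nhds_iff_ball.1 (hA.and hbound)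
  have hB : (0 : ℝ) < K * (‖x₀‖ + 1) := by rw [hK]; positivity
  set r : ℝ := min (δ / 2) (1 / (K * (‖x₀‖ + 1)))
  have hr0 : 0 < r := by positivity
  have hrB : K * (‖x₀‖ + 1) * r ≤ 1 := (le_div_iff₀' hB).1 (min_le_right _ _)
  have hin : ∀ t ∈ Set.Icc (t₀ - r) (t₀ + r), ContinuousAt A t ∧ ‖A t‖₊ ≤ K := fun t ht =>
    hball t (Metric.closedBall_subset_ball ((min_le_left _ _).trans_lt (half_lt_self hδ))
      (Real.closedBall_eq_Icc ▸ ht))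
  obtain ⟨x, hx₀, hx⟩ := (isPicardLindelof_linear (x₀ := x₀) (K := K)
    (t := ⟨t₀, by constructor <;> linarith⟩)
    (fun t ht => (hin t ht).1.continuousWithinAt) (fun t ht => (hin t ht).2)
    (by simpa using hrB)).exists_eq_forall_mem_Icc_hasDerivWithinAt₀
  refine ⟨x, hx₀, ?_⟩
  filter_upwards [Ioo_mem_nhds (sub_lt_self t₀ hr0) (lt_add_of_pos_right t₀ hr0)] with t ht
  exact (hx t (Set.Ioo_subset_Icc_self ht)).hasDerivAt (Icc_mem_nhds ht.1 ht.2)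

lemma exists_fundamental_solution (hA : ∀ᶠ s in 𝓝 t₀, ContinuousAt A s) :
    ∃ X : ℝ → E →L[ℝ] E, ∀ᶠ t in 𝓝 t₀, HasDerivAt X (A t ∘L X t) t ∧ IsUnit (X t) := by
  obtain ⟨X, hX₀, hX⟩ := exists_eventually_hasDerivAt_linear
    (A := fun t => ContinuousLinearMap.compL ℝ E E E (A t))
    (hA.mono fun t ht => ((ContinuousLinearMap.compL ℝ E E E).continuous.continuousAt.comp ht))
    (1 : E →L[ℝ] E)
  have hunit : ∀ᶠ t in 𝓝 t₀, IsUnit (X t) :=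
    hX.self_of_nhds.continuousAt.preimage_mem_nhds
      (Units.isOpen.mem_nhds (show IsUnit (X t₀) from hX₀ ▸ isUnit_one))
  exact ⟨X, hX.and hunit⟩

end LinearODE

section ImplicitLinearODE

variable {E : Type*} [NormedAddCommGroup E] [NormedSpace ℝ E] [FiniteDimensional ℝ E]

lemma isInvertible_of_injective {G : E →L[ℝ] E →L[ℝ] ℝ} (hG : Function.Injective G) :
    G.IsInvertible := by
  have hdim : Module.finrank ℝ E = Module.finrank ℝ (E →L[ℝ] ℝ) := by
    rw [← (LinearMap.toContinuousLinearMap (𝕜 := ℝ) (E := E) (F' := ℝ)).finrank_eq]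
    exact (Subspace.dual_finrank_eq (K := ℝ) (V := E)).symm
  exact ⟨(LinearEquiv.ofInjectiveOfFinrankEq G.toLinearMap hG hdim).toContinuousLinearEquiv, rfl⟩

lemma exists_nhds_forall_exists_implicit_solution {G Γ : ℝ → E →L[ℝ] E →L[ℝ] ℝ} {t₀ : ℝ}
    (hG : ∀ᶠ s in 𝓝 t₀, ContinuousAt G s ∧ Function.Injective (G s))
    (hΓ : ∀ᶠ s in 𝓝 t₀, ContinuousAt Γ s) :
    ∃ U ∈ 𝓝 t₀, ∀ t₁ ∈ U, ∀ u : E, ∃ v : ℝ → E, v t₁ = u ∧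
      ∀ t ∈ U, ∃ v', HasDerivAt v v' t ∧ G t v' + Γ t (v t) = 0 := by
  have : CompleteSpace E := FiniteDimensional.complete ℝ E
  have hinv : ∀ᶠ s in 𝓝 t₀, (G s).IsInvertible := hG.mono fun s hs =>
    isInvertible_of_injective hs.2
  obtain ⟨X, hX⟩ := exists_fundamental_solution (t₀ := t₀)
    (A := fun s => -((G s).inverse ∘L Γ s)) (by
      filter_upwards [hG, hinv, hΓ] with s hs hinv hs'
      exact ((hinv.contDiffAt_map_inverse (n := 0)).continuousAt.comp hs.1).clm_comp hs' |>.neg)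
  refine ⟨_, hX.and hinv, fun t₁ ht₁ u => ?_⟩
  obtain ⟨Y, hY⟩ := ht₁.1.2
  refine ⟨fun t => X t ((↑Y⁻¹ : E →L[ℝ] E) u), ?_, fun t ht => ⟨_,
    ht.1.1.clm_apply (hasDerivAt_const t _), ?_⟩⟩
  · change X t₁ _ = u
    rw [← hY]
    exact DFunLike.congr_fun Y.mul_inv u
  · simp [ht.2.self_apply_inverse]

end ImplicitLinearODE

section MetricCalculus

-- The norm on `E →L[ℝ] E →L[ℝ] ℝ` is not found otherwise.
set_option maxSynthPendingDepth 3

variable {E F : Type*} [NormedAddCommGroup E] [NormedSpace ℝ E] [NormedAddCommGroup F]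
  [NormedSpace ℝ F]

/-- The Christoffel symbols of the first kind `Γ(u, w, z) = G(∇_u w, z)`, for constant fields `u`,
`w`, `z`, of a metric `G` on a normed space, as a bilinear form in `w` and `z`. -/
def christoffelForm (G : E → E →L[ℝ] E →L[ℝ] ℝ) (y u : E) : E →L[ℝ] E →L[ℝ] ℝ :=
  (2⁻¹ : ℝ) • (fderiv ℝ G y u + (fderiv ℝ G y).flip u - ((fderiv ℝ G y).flip u).flip)

variable {G : E → E →L[ℝ] E →L[ℝ] ℝ} {y : E}

lemma christoffelForm_apply (u w z : E) :
    christoffelForm G y u w z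
      = (fderiv ℝ G y u w z + fderiv ℝ G y w u z - fderiv ℝ G y z u w) / 2 := by
  simp [christoffelForm, div_eq_inv_mul]

lemma christoffelForm_smul (a : ℝ) (u w : E) :
    christoffelForm G y (a • u) w = a • christoffelForm G y u w := by
  ext z
  simp only [christoffelForm_apply, map_smul, smul_apply, smul_eq_mul]
  ring

lemma hasFDerivAt_apply_apply (hG : DifferentiableAt ℝ G y) (w z : E) :
    HasFDerivAt (fun x => G x w z) (((fderiv ℝ G y).flip w).flip z) y := by
  simpa using! (hG.hasFDerivAt.clm_apply (hasFDerivAt_const w y)).clm_apply (hasFDerivAt_const z y)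

lemma fderiv_apply_symm (hG : DifferentiableAt ℝ G y) (hsymm : ∀ x u w, G x u w = G x w u)
    (u w z : E) : fderiv ℝ G y u w z = fderiv ℝ G y u z w := by
  have h := hasFDerivAt_apply_apply hG w z
  simp only [fun x => hsymm x w z] at h
  exact DFunLike.congr_fun (h.unique (hasFDerivAt_apply_apply hG z w)) u

-- Metric compatibility: `∂_u G(w, z) = G(∇_u w, z) + G(w, ∇_u z)`.
lemma christoffelForm_add_swap (hG : DifferentiableAt ℝ G y)
    (hsymm : ∀ x u w, G x u w = G x w u) (u w z : E) :
    christoffelForm G y u w z + christoffelForm G y u z w = fderiv ℝ G y u w z := by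
  rw [christoffelForm_apply, christoffelForm_apply, fderiv_apply_symm hG hsymm u z w]
  ring

section Pullback

variable {G' : F → F →L[ℝ] F →L[ℝ] ℝ} {τ : E → F}

lemma fderiv_pullback (hG : DifferentiableAt ℝ G y) (hG' : DifferentiableAt ℝ G' (τ y))
    (hτ : ContDiffAt ℝ 2 τ y)
    (hpull : ∀ᶠ x in 𝓝 y, ∀ u w, G x u w = G' (τ x) (fderiv ℝ τ x u) (fderiv ℝ τ x w))
    (u w z : E) :
    fderiv ℝ G y u w z
      = fderiv ℝ G' (τ y) (fderiv ℝ τ y u) (fderiv ℝ τ y w) (fderiv ℝ τ y z)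
        + G' (τ y) (fderiv ℝ (fderiv ℝ τ) y u w) (fderiv ℝ τ y z)
        + G' (τ y) (fderiv ℝ τ y w) (fderiv ℝ (fderiv ℝ τ) y u z) := by
  have hτ' := (hτ.differentiableAt two_ne_zero).hasFDerivAt
  have hdτ := ((hτ.fderiv_right (m := 1) le_rfl).differentiableAt one_ne_zero).hasFDerivAt
  have hright := ((hG'.hasFDerivAt.comp y hτ').clm_apply
    (hdτ.clm_apply (hasFDerivAt_const w y))).clm_apply (hdτ.clm_apply (hasFDerivAt_const z y))
  have h := DFunLike.congr_fun ((hasFDerivAt_apply_apply hG w z).unique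
    (hright.congr_of_eventuallyEq (hpull.mono fun x hx => hx w z))) u
  simp only [add_apply, ContinuousLinearMap.comp_apply, zero_apply, map_zero, zero_add,
    ContinuousLinearMap.flip_apply, Function.comp_apply] at h
  linear_combination h

lemma christoffelForm_pullback (hG : DifferentiableAt ℝ G y) (hG' : DifferentiableAt ℝ G' (τ y))
    (hsymm : ∀ x u w, G' x u w = G' x w u) (hτ : ContDiffAt ℝ 2 τ y)
    (hpull : ∀ᶠ x in 𝓝 y, ∀ u w, G x u w = G' (τ x) (fderiv ℝ τ x u) (fderiv ℝ τ x w))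
    (u w z : E) :
    christoffelForm G y u w z
      = christoffelForm G' (τ y) (fderiv ℝ τ y u) (fderiv ℝ τ y w) (fderiv ℝ τ y z)
        + G' (τ y) (fderiv ℝ (fderiv ℝ τ) y u w) (fderiv ℝ τ y z) := by
  have hsnd : IsSymmSndFDerivAt ℝ τ y :=
    hτ.isSymmSndFDerivAt (by rw [minSmoothness_of_isRCLikeNormedField])
  simp only [christoffelForm_apply, fderiv_pullback hG hG' hτ hpull]
  rw [hsnd.eq w u, hsnd.eq w z, hsnd.eq z u, hsymm _ (fderiv ℝ τ y w)]
  ring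

end Pullback

/-- The field `v` along the curve `c` is parallel at time `t` for the Levi-Civita connection of the
metric `G` on a normed space: `v' + Γ(c', v) = 0`, with the index lowered by `G`. -/
def IsParallelAt (G : E → E →L[ℝ] E →L[ℝ] ℝ) (c v : ℝ → E) (t : ℝ) : Prop :=
  ∃ c' v', HasDerivAt c c' t ∧ HasDerivAt v v' t ∧
    G (c t) v' + christoffelForm G (c t) c' (v t) = 0

namespace IsParallelAt

variable {c v w : ℝ → E} {t : ℝ}

lemma add (hv : IsParallelAt G c v t) (hw : IsParallelAt G c w t) :
    IsParallelAt G c (fun s => v s + w s) t := by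
  obtain ⟨c', v', hc, hv, hv'⟩ := hv
  obtain ⟨c₁', w', hc₁, hw, hw'⟩ := hw
  obtain rfl := hc.unique hc₁
  refine ⟨c', v' + w', hc, hv.add hw, ?_⟩
  rw [map_add, map_add, add_add_add_comm, hv', hw', add_zero]

lemma const_smul (hv : IsParallelAt G c v t) (a : ℝ) : IsParallelAt G c (fun s => a • v s) t := by
  obtain ⟨c', v', hc, hv, hv'⟩ := hv
  refine ⟨c', a • v', hc, hv.const_smul a, ?_⟩
  rw [map_smul, map_smul, ← smul_add, hv', smul_zero]

lemma congr {c₁ v₁ : ℝ → E} (hv : IsParallelAt G c v t) (hc₁ : c₁ =ᶠ[𝓝 t] c)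
    (hv₁ : v₁ =ᶠ[𝓝 t] v) : IsParallelAt G c₁ v₁ t := by
  obtain ⟨c', v', hc, hv, hv'⟩ := hv
  refine ⟨c', v', hc.congr_of_eventuallyEq hc₁, hv.congr_of_eventuallyEq hv₁, ?_⟩
  rwa [hc₁.eq_of_nhds, hv₁.eq_of_nhds]

lemma comp_mul {r : ℝ} (hv : IsParallelAt G c v (r * t)) :
    IsParallelAt G (fun s => c (r * s)) (fun s => v (r * s)) t := by
  obtain ⟨c', v', hc, hv, hv'⟩ := hv
  have hr : HasDerivAt (fun s => r * s) r t := by simpa using (hasDerivAt_id t).const_mul r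
  refine ⟨r • c', r • v', hc.scomp t hr, hv.scomp t hr, ?_⟩
  rw [map_smul, christoffelForm_smul, ← smul_add, hv', smul_zero]

lemma map {G' : F → F →L[ℝ] F →L[ℝ] ℝ} {τ : E → F} (hv : IsParallelAt G c v t)
    (hG : DifferentiableAt ℝ G (c t)) (hG' : DifferentiableAt ℝ G' (τ (c t)))
    (hsymm : ∀ x u w, G' x u w = G' x w u) (hτ : ContDiffAt ℝ 2 τ (c t))
    (hsurj : Function.Surjective (fderiv ℝ τ (c t)))
    (hpull : ∀ᶠ x in 𝓝 (c t), ∀ u w, G x u w = G' (τ x) (fderiv ℝ τ x u) (fderiv ℝ τ x w)) :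
    IsParallelAt G' (fun s => τ (c s)) (fun s => fderiv ℝ τ (c s) (v s)) t := by
  obtain ⟨c', v', hc, hv, hv'⟩ := hv
  have hτc := (hτ.differentiableAt two_ne_zero).hasFDerivAt.comp_hasDerivAt t hc
  have hdτ := ((hτ.fderiv_right (m := 1) le_rfl).differentiableAt one_ne_zero).hasFDerivAt
  refine ⟨_, _, hτc, (hdτ.comp_hasDerivAt t hc).clm_apply hv, ?_⟩
  ext z'
  obtain ⟨z, rfl⟩ := hsurj z'
  have h := DFunLike.congr_fun hv' z
  simp only [add_apply, zero_apply, hpull.self_of_nhds,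
    christoffelForm_pullback hG hG' hsymm hτ hpull] at h
  simp only [add_apply, zero_apply, map_add, Function.comp_apply]
  linarith

lemma hasDerivAt_metric (hv : IsParallelAt G c v t) (hw : IsParallelAt G c w t)
    (hG : DifferentiableAt ℝ G (c t)) (hsymm : ∀ x u w, G x u w = G x w u) :
    HasDerivAt (fun s => G (c s) (v s) (w s)) 0 t := by
  obtain ⟨c', v', hc, hv, hv'⟩ := hv
  obtain ⟨c₁', w', hc₁, hw, hw'⟩ := hw
  obtain rfl := hc.unique hc₁
  refine (((hG.hasFDerivAt.comp_hasDerivAt t hc).clm_apply hv).clm_apply hw).congr_deriv ?_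
  have hvw := DFunLike.congr_fun hv' (w t)
  have hwv := DFunLike.congr_fun hw' (v t)
  simp only [add_apply, zero_apply, Function.comp_apply] at hvw hwv ⊢
  rw [← christoffelForm_add_swap hG hsymm, hsymm _ _ w']
  linarith

end IsParallelAt

lemma continuousAt_christoffelForm (hG : ContDiffAt ℝ 1 G y) (u : E) :
    ContinuousAt (fun z : E × E => christoffelForm G z.1 z.2) (y, u) := by
  have hD : ContinuousAt (fun z : E × E => fderiv ℝ G z.1) (y, u) :=
    (hG.fderiv_right (m := 0) le_rfl).continuousAt.comp' continuousAt_fst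
  have hflip : ContinuousAt (fun z : E × E => (fderiv ℝ G z.1).flip z.2) (y, u) :=
    ((ContinuousLinearMap.flipₗᵢ ℝ E E _).continuous.continuousAt.comp' hD).clm_apply
      continuousAt_snd
  exact (((hD.clm_apply continuousAt_snd).add hflip).sub
    ((ContinuousLinearMap.flipₗᵢ ℝ E E ℝ).continuous.continuousAt.comp' hflip)).const_smul (2⁻¹ : ℝ)

lemma exists_nhds_forall_exists_isParallelAt [FiniteDimensional ℝ E] {c : ℝ → E} {t₀ : ℝ}
    (hc : ∀ᶠ s in 𝓝 t₀, ContDiffAt ℝ 1 c s)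
    (hG : ∀ᶠ s in 𝓝 t₀, ContDiffAt ℝ 1 G (c s) ∧ Function.Injective (G (c s))) :
    ∃ U ∈ 𝓝 t₀, ∀ t₁ ∈ U, ∀ u : E, ∃ v : ℝ → E, v t₁ = u ∧ ∀ t ∈ U, IsParallelAt G c v t := by
  obtain ⟨U, hU, hsol⟩ := exists_nhds_forall_exists_implicit_solution
    (G := fun s => G (c s)) (Γ := fun s => christoffelForm G (c s) (deriv c s)) (t₀ := t₀)
    (by
      filter_upwards [hc, hG] with s hcs hGs
      exact ⟨hGs.1.continuousAt.comp hcs.continuousAt, hGs.2⟩)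
    (by
      filter_upwards [hc, hG] with s hcs hGs
      have hderiv : ContinuousAt (deriv c) s :=
        (hcs.fderiv_right (m := 0) le_rfl).continuousAt.clm_apply continuousAt_const
      exact (continuousAt_christoffelForm hGs.1 _).comp'
        (f := fun s => (c s, deriv c s)) (hcs.continuousAt.prodMk hderiv))
  refine ⟨U ∩ {s | ContDiffAt ℝ 1 c s}, Filter.inter_mem hU hc, fun t₁ ht₁ u => ?_⟩
  obtain ⟨v, hv, hv'⟩ := hsol t₁ ht₁.1 u
  refine ⟨v, hv, fun t ⟨htU, (hct : ContDiffAt ℝ 1 c t)⟩ => ?_⟩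
  obtain ⟨v', hvt, h⟩ := hv' t htU
  exact ⟨deriv c t, v', (hct.differentiableAt one_ne_zero).hasDerivAt, hvt, h⟩

end MetricCalculus

section Coordinates

variable {d : ℕ} {M : Type*} [TopologicalSpace M]
  [ChartedSpace (EuclideanSpace ℝ (Fin d)) M] [IsManifold (𝓡 d) ∞ M] {p p' q : M}

lemma ofCoord_toCoord (hq : q ∈ (extChartAt (𝓡 d) p).source) (v : TangentSpace (𝓡 d) q) :
    ofCoord p q (toCoord p q v) = v :=
  Trivialization.symmL_continuousLinearMapAt _ (by simpa using hq) v

lemma toCoord_ofCoord (hq : q ∈ (extChartAt (𝓡 d) p).source) (u : EuclideanSpace ℝ (Fin d)) :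
    toCoord p q (ofCoord p q u) = u :=
  Trivialization.continuousLinearMapAt_symmL _ (by simpa using hq) u

lemma toCoord_eq_mfderiv (hq : q ∈ (extChartAt (𝓡 d) p).source) (v : TangentSpace (𝓡 d) q) :
    toCoord p q v = mfderiv (𝓡 d) 𝓘(ℝ, EuclideanSpace ℝ (Fin d)) (extChartAt (𝓡 d) p) q v := by
  rw [toCoord, TangentBundle.continuousLinearMapAt_trivializationAt (by simpa using hq)]
  rfl

/-- The change of coordinates from the chart around `p` to the chart around `p'`. -/
def transition (p p' : M) : EuclideanSpace ℝ (Fin d) → EuclideanSpace ℝ (Fin d) :=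
  extChartAt (𝓡 d) p' ∘ (extChartAt (𝓡 d) p).symm

omit [IsManifold (𝓡 d) ∞ M] in
lemma transition_extChartAt (hq : q ∈ (extChartAt (𝓡 d) p).source) :
    transition (d := d) p p' (extChartAt (𝓡 d) p q) = extChartAt (𝓡 d) p' q :=
  congrArg _ ((extChartAt (𝓡 d) p).left_inv hq)

lemma contDiffAt_transition (hq : q ∈ (extChartAt (𝓡 d) p).source)
    (hq' : q ∈ (extChartAt (𝓡 d) p').source) :
    ContDiffAt ℝ ∞ (transition (d := d) p p') (extChartAt (𝓡 d) p q) := by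
  have h : extChartAt (𝓡 d) p q ∈ ((extChartAt (𝓡 d) p).symm ≫ extChartAt (𝓡 d) p').source := by
    rw [PartialEquiv.trans_source'', PartialEquiv.symm_symm, PartialEquiv.symm_target]
    exact Set.mem_image_of_mem _ ⟨hq, hq'⟩
  simpa [transition, contDiffWithinAt_univ] using
    contDiffWithinAt_ext_coord_change (I := 𝓡 d) (n := ∞) p' p h

lemma toCoord_transition (hq : q ∈ (extChartAt (𝓡 d) p).source)
    (hq' : q ∈ (extChartAt (𝓡 d) p').source) (v : TangentSpace (𝓡 d) q) :
    toCoord p' q v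
      = fderiv ℝ (transition (d := d) p p') (extChartAt (𝓡 d) p q) (toCoord p q v) := by
  have h := mfderiv_comp q (I := 𝓡 d)
    ((contDiffAt_transition hq hq').differentiableAt (by simp)).mdifferentiableAt
    (mdifferentiableAt_extChartAt (I := 𝓡 d) (by simpa using hq))
  have hev : transition (d := d) p p' ∘ extChartAt (𝓡 d) p =ᶠ[𝓝 q] extChartAt (𝓡 d) p' := by
    filter_upwards [extChartAt_source_mem_nhds' hq] with x hx using transition_extChartAt hx
  rw [hev.mfderiv_eq] at h
  rw [toCoord_eq_mfderiv hq, toCoord_eq_mfderiv hq', h, mfderiv_eq_fderiv]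
  rfl

lemma hasDerivAt_extChartAt_comp {γ : ℝ → M} {t : ℝ}
    (hγ : MDifferentiableAt 𝓘(ℝ, ℝ) (𝓡 d) γ t) (hp : γ t ∈ (extChartAt (𝓡 d) p).source) :
    HasDerivAt (fun s => extChartAt (𝓡 d) p (γ s)) (toCoord p (γ t) (velocity γ t)) t := by
  have hφ : MDifferentiableAt (𝓡 d) 𝓘(ℝ, EuclideanSpace ℝ (Fin d)) (extChartAt (𝓡 d) p) (γ t) :=
    mdifferentiableAt_extChartAt (by simpa using hp)
  have h := (hφ.comp t hγ).differentiableAt.hasFDerivAt.hasDerivAt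
  rw [← mfderiv_eq_fderiv, mfderiv_comp t hφ hγ] at h
  rw [toCoord_eq_mfderiv hp]
  exact h

lemma contMDiffAt_ofCoord (hq : q ∈ (extChartAt (𝓡 d) p).source)
    (u : EuclideanSpace ℝ (Fin d)) :
    ContMDiffAt 𝓘(ℝ, EuclideanSpace ℝ (Fin d)) ((𝓡 d).prod 𝓘(ℝ, EuclideanSpace ℝ (Fin d))) ∞
      (fun y => (⟨(extChartAt (𝓡 d) p).symm y, ofCoord p ((extChartAt (𝓡 d) p).symm y) u⟩ :
        TangentBundle (𝓡 d) M)) (extChartAt (𝓡 d) p q) := by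
  have hy := (extChartAt (𝓡 d) p).map_source hq
  have hnhds := (isOpen_extChartAt_target (I := 𝓡 d) p).mem_nhds hy
  rw [Trivialization.contMDiffAt_iff (e := trivializationAt (EuclideanSpace ℝ (Fin d))
    (TangentSpace (𝓡 d) : M → Type _) p)
    (by rw [(extChartAt (𝓡 d) p).left_inv hq]; simpa using hq)]
  refine ⟨(contMDiffOn_extChartAt_symm p).contMDiffAt hnhds,
    (contMDiffAt_const (c := u)).congr_of_eventuallyEq ?_⟩
  filter_upwards [hnhds] with y hy
  have hsource := (extChartAt (𝓡 d) p).map_target hy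
  have h := toCoord_ofCoord hsource u
  rw [toCoord, Trivialization.continuousLinearMapAt_apply, Trivialization.linearMapAt_apply] at h
  exact (if_pos (by simpa using hsource)).symm.trans h

end Coordinates

section ChartMetric

variable {d : ℕ} {M : Type*} [TopologicalSpace M]
  [ChartedSpace (EuclideanSpace ℝ (Fin d)) M] [IsManifold (𝓡 d) ∞ M]
  [RiemannianBundle (fun x : M => TangentSpace (𝓡 d) x)] {p p' q : M}

/-- The metric `chartMetric p` in the chart around `p`, as a field of continuous bilinear forms. -/
def chartForm (p : M) (y : EuclideanSpace ℝ (Fin d)) :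
    EuclideanSpace ℝ (Fin d) →L[ℝ] EuclideanSpace ℝ (Fin d) →L[ℝ] ℝ :=
  let e := trivializationAt (EuclideanSpace ℝ (Fin d)) (TangentSpace (𝓡 d) : M → Type _) p
  (innerSL ℝ).bilinearComp (e.symmL ℝ ((extChartAt (𝓡 d) p).symm y))
    (e.symmL ℝ ((extChartAt (𝓡 d) p).symm y))

lemma chartForm_apply (p : M) (y u w : EuclideanSpace ℝ (Fin d)) :
    chartForm p y u w = chartMetric p y u w := rfl

lemma chartForm_symm (p : M) (y u w : EuclideanSpace ℝ (Fin d)) :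
    chartForm p y u w = chartForm p y w u := by
  simp only [chartForm_apply, chartMetric, real_inner_comm]

lemma chartForm_toCoord (hq : q ∈ (extChartAt (𝓡 d) p).source) (v w : TangentSpace (𝓡 d) q) :
    chartForm p (extChartAt (𝓡 d) p q) (toCoord p q v) (toCoord p q w) = inner ℝ v w := by
  rw [chartForm_apply, chartMetric, (extChartAt (𝓡 d) p).left_inv hq, ofCoord_toCoord hq,
    ofCoord_toCoord hq]

lemma chartForm_injective (hq : q ∈ (extChartAt (𝓡 d) p).source) :
    Function.Injective (chartForm (d := d) p (extChartAt (𝓡 d) p q)) := by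
  refine (injective_iff_map_eq_zero _).2 fun v hv => ?_
  have hinner := chartForm_toCoord hq (ofCoord p q v) (ofCoord p q v)
  rw [toCoord_ofCoord hq, hv, zero_apply, eq_comm, inner_self_eq_zero] at hinner
  rw [← toCoord_ofCoord hq v, hinner]
  exact map_zero _

lemma eventually_chartForm_eq_transition (hq : q ∈ (extChartAt (𝓡 d) p).source)
    (hq' : q ∈ (extChartAt (𝓡 d) p').source) :
    ∀ᶠ y in 𝓝 (extChartAt (𝓡 d) p q), ∀ u w,
      chartForm p y u w = chartForm p' (transition (d := d) p p' y)
        (fderiv ℝ (transition (d := d) p p') y u) (fderiv ℝ (transition (d := d) p p') y w) := by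
  have hsymm : ContinuousAt (extChartAt (𝓡 d) p).symm (extChartAt (𝓡 d) p q) :=
    continuousAt_extChartAt_symm' hq
  have hleft := (extChartAt (𝓡 d) p).left_inv hq
  filter_upwards [(isOpen_extChartAt_target p).mem_nhds ((extChartAt (𝓡 d) p).map_source hq),
    hsymm.preimage_mem_nhds (extChartAt_source_mem_nhds' (hleft.symm ▸ hq'))] with y hy hy' u w
  have hs := (extChartAt (𝓡 d) p).map_target hy
  obtain ⟨x, hx, rfl⟩ : ∃ x ∈ (extChartAt (𝓡 d) p).source, extChartAt (𝓡 d) p x = y :=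
    ⟨_, hs, (extChartAt (𝓡 d) p).right_inv hy⟩
  rw [Set.mem_preimage, (extChartAt (𝓡 d) p).left_inv hx] at hy'
  have h := chartForm_toCoord hy' (ofCoord p x u) (ofCoord p x w)
  rw [← chartForm_toCoord hx, toCoord_transition hx hy', toCoord_transition hx hy',
    toCoord_ofCoord hx, toCoord_ofCoord hx] at h
  rw [← h, transition_extChartAt hx]

variable [IsContMDiffRiemannianBundle (𝓡 d) 1 (EuclideanSpace ℝ (Fin d))
  (fun x : M => TangentSpace (𝓡 d) x)]

lemma contDiffOn_chartForm (p : M) :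
    ContDiffOn ℝ 1 (chartForm (d := d) p) (extChartAt (𝓡 d) p).target := by
  rw [contDiffOn_clm_apply]
  intro u
  rw [contDiffOn_clm_apply]
  intro w y hy
  have hcoord := fun u => (contMDiffAt_ofCoord ((extChartAt (𝓡 d) p).map_target hy) u).of_le
    (m := 1) (by simp)
  rw [(extChartAt (𝓡 d) p).right_inv hy] at hcoord
  exact ((hcoord u).inner_bundle (hcoord w)).contDiffAt.contDiffWithinAt

lemma contDiffAt_chartForm (hq : q ∈ (extChartAt (𝓡 d) p).source) :
    ContDiffAt ℝ 1 (chartForm (d := d) p) (extChartAt (𝓡 d) p q) :=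
  (contDiffOn_chartForm p).contDiffAt
    ((isOpen_extChartAt_target p).mem_nhds ((extChartAt (𝓡 d) p).map_source hq))

lemma differentiableAt_chartForm (hq : q ∈ (extChartAt (𝓡 d) p).source) :
    DifferentiableAt ℝ (chartForm (d := d) p) (extChartAt (𝓡 d) p q) :=
  (contDiffAt_chartForm hq).differentiableAt one_ne_zero

lemma christoffel_eq_christoffelForm (hq : q ∈ (extChartAt (𝓡 d) p).source)
    (u w z : EuclideanSpace ℝ (Fin d)) :
    christoffel p (extChartAt (𝓡 d) p q) u w z
      = christoffelForm (chartForm (d := d) p) (extChartAt (𝓡 d) p q) u w z := by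
  have h := fun a b c => DFunLike.congr_fun
    (hasFDerivAt_apply_apply (differentiableAt_chartForm hq) b c).fderiv a
  simp only [chartForm_apply] at h
  simp only [christoffel, christoffelForm_apply, h, ContinuousLinearMap.flip_apply]

end ChartMetric

section ParallelFields

variable {d : ℕ} {M : Type*} [TopologicalSpace M]
  [ChartedSpace (EuclideanSpace ℝ (Fin d)) M] [IsManifold (𝓡 d) ∞ M]
  [RiemannianBundle (fun x : M => TangentSpace (𝓡 d) x)]
  {p p' : M} {γ : ℝ → M} {V W : ∀ t, TangentSpace (𝓡 d) (γ t)} {t : ℝ}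

/-- The field `V` along `γ` is parallel at time `t`, according to the chart around `p`. Unlike in
`IsParallelAlong`, the chart does not move with `t`. -/
def IsParallelIn (p : M) (γ : ℝ → M) (V : ∀ t, TangentSpace (𝓡 d) (γ t)) (t : ℝ) : Prop :=
  IsParallelAt (chartForm p) (fun s => extChartAt (𝓡 d) p (γ s))
    (fun s => toCoord p (γ s) (V s)) t

lemma IsParallelIn.add (hV : IsParallelIn p γ V t) (hW : IsParallelIn p γ W t) :
    IsParallelIn p γ (fun s => V s + W s) t := by
  simpa only [IsParallelIn, toCoord, map_add] using IsParallelAt.add hV hW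

lemma IsParallelIn.const_smul (hV : IsParallelIn p γ V t) (a : ℝ) :
    IsParallelIn p γ (fun s => a • V s) t := by
  simpa only [IsParallelIn, toCoord, map_smul] using IsParallelAt.const_smul hV a

lemma IsParallelIn.congr (hV : IsParallelIn p γ V t) (hW : ∀ᶠ s in 𝓝 t, W s = V s) :
    IsParallelIn p γ W t :=
  IsParallelAt.congr hV .rfl (hW.mono fun _ hs => congrArg (toCoord p _) hs)

lemma IsParallelAlong.mdifferentiable (hV : IsParallelAlong γ V) :
    MDifferentiable 𝓘(ℝ, ℝ) (𝓡 d) γ :=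
  fun t => (hV t).1

lemma IsGeodesic.mdifferentiable (hγ : IsGeodesic (d := d) γ) :
    MDifferentiable 𝓘(ℝ, ℝ) (𝓡 d) γ :=
  IsParallelAlong.mdifferentiable hγ

variable [IsContMDiffRiemannianBundle (𝓡 d) 1 (EuclideanSpace ℝ (Fin d))
  (fun x : M => TangentSpace (𝓡 d) x)]

lemma isParallelAlong_iff :
    IsParallelAlong γ V ↔
      ∀ t, MDifferentiableAt 𝓘(ℝ, ℝ) (𝓡 d) γ t ∧ IsParallelIn (γ t) γ V t := by
  refine forall_congr' fun t => and_congr_right fun hγ => ?_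
  have hp := mem_extChartAt_source (I := 𝓡 d) (γ t)
  have hc := hasDerivAt_extChartAt_comp hγ hp
  simp only [christoffel_eq_christoffelForm hp, ← chartForm_apply, hc.deriv]
  constructor
  · rintro ⟨v', hv, h⟩
    exact ⟨_, v', hc, hv, ContinuousLinearMap.ext h⟩
  · rintro ⟨c', v', hc', hv, h⟩
    obtain rfl := hc'.unique hc
    exact ⟨v', hv, DFunLike.congr_fun h⟩

lemma IsParallelIn.change_chart (hV : IsParallelIn p γ V t) (hγ : ContinuousAt γ t)
    (hp : γ t ∈ (extChartAt (𝓡 d) p).source) (hp' : γ t ∈ (extChartAt (𝓡 d) p').source) :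
    IsParallelIn p' γ V t := by
  have hev : ∀ᶠ s in 𝓝 t, γ s ∈ (extChartAt (𝓡 d) p).source ∩ (extChartAt (𝓡 d) p').source :=
    hγ.preimage_mem_nhds (Filter.inter_mem (extChartAt_source_mem_nhds' hp)
      (extChartAt_source_mem_nhds' hp'))
  have hsurj : Function.Surjective
      (fderiv ℝ (transition (d := d) p p') (extChartAt (𝓡 d) p (γ t))) := fun z =>
    ⟨_, (toCoord_transition hp hp' (ofCoord p' (γ t) z)).symm.trans (toCoord_ofCoord hp' z)⟩
  refine (IsParallelAt.map hV (differentiableAt_chartForm hp)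
    (transition_extChartAt (p' := p') hp ▸ differentiableAt_chartForm hp') (chartForm_symm p')
    ((contDiffAt_transition hp hp').of_le (by norm_cast)) hsurj
    (eventually_chartForm_eq_transition hp hp')).congr ?_ ?_
  · filter_upwards [hev] with s hs using (transition_extChartAt hs.1).symm
  · filter_upwards [hev] with s hs using toCoord_transition hs.1 hs.2 _

lemma IsParallelIn.hasDerivAt_inner (hV : IsParallelIn p γ V t) (hW : IsParallelIn p γ W t)
    (hγ : ContinuousAt γ t) (hp : γ t ∈ (extChartAt (𝓡 d) p).source) :
    HasDerivAt (fun s => inner ℝ (V s) (W s)) 0 t := by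
  refine (IsParallelAt.hasDerivAt_metric hV hW (differentiableAt_chartForm hp)
    (chartForm_symm p)).congr_of_eventuallyEq ?_
  filter_upwards [hγ.preimage_mem_nhds (extChartAt_source_mem_nhds' hp)] with s hs
  exact (chartForm_toCoord hs _ _).symm

lemma isUniqueLocalCondition_isParallelIn (hγ : Continuous γ) :
    IsUniqueLocalCondition (fun V t => IsParallelIn (d := d) (γ t) γ V t) where
  congr hV hW := hV.congr hW
  unique {V W U} hU hU' hV hW s hs hVW t ht := by
    have hsub : ∀ r ∈ U, HasDerivAt
        (fun r => inner ℝ (V r + (-1 : ℝ) • W r) (V r + (-1 : ℝ) • W r)) 0 r := fun r hr =>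
      have h := (hV r hr).add ((hW r hr).const_smul (-1))
      h.hasDerivAt_inner h hγ.continuousAt (mem_extChartAt_source _)
    have hconst := hU.is_const_of_deriv_eq_zero hU'.isPreconnected
      (fun r hr => (hsub r hr).differentiableAt.differentiableWithinAt)
      (fun r hr => (hsub r hr).deriv) ht hs
    rw [hVW, neg_one_smul, neg_one_smul, add_neg_cancel, inner_zero_left, inner_self_eq_zero,
      ← sub_eq_add_neg] at hconst
    exact sub_eq_zero.1 hconst

lemma exists_nhds_forall_exists_isParallelIn (hγ : ContMDiff 𝓘(ℝ, ℝ) (𝓡 d) 1 γ) (t₀ : ℝ) :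
    ∃ U ∈ 𝓝 t₀, ∀ t₁ ∈ U, ∀ u, ∃ V, V t₁ = u ∧ ∀ t ∈ U, IsParallelIn (d := d) (γ t) γ V t := by
  have hsource : ∀ᶠ s in 𝓝 t₀, γ s ∈ (extChartAt (𝓡 d) (γ t₀)).source :=
    hγ.continuous.continuousAt.preimage_mem_nhds (extChartAt_source_mem_nhds _)
  obtain ⟨U, hU, hsol⟩ := exists_nhds_forall_exists_isParallelAt (t₀ := t₀)
    (G := chartForm (d := d) (γ t₀)) (c := fun s => extChartAt (𝓡 d) (γ t₀) (γ s))
    (hsource.mono fun s hs =>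
      ((contMDiffAt_extChartAt' (by simpa using hs)).comp s (hγ s)).contDiffAt)
    (hsource.mono fun s hs => ⟨contDiffAt_chartForm hs, chartForm_injective hs⟩)
  refine ⟨_, Filter.inter_mem hU hsource.eventually_nhds, fun t₁ ht₁ u => ?_⟩
  obtain ⟨v, hv, hpar⟩ := hsol t₁ ht₁.1 (toCoord (γ t₀) (γ t₁) u)
  refine ⟨fun t => ofCoord (γ t₀) (γ t) (v t), ?_, fun t ht => ?_⟩
  · simp only [hv]
    exact ofCoord_toCoord ht₁.2.self_of_nhds u
  · have h : IsParallelIn (γ t₀) γ (fun t => ofCoord (γ t₀) (γ t) (v t)) t :=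
      (hpar t ht.1).congr .rfl (ht.2.mono fun s hs => toCoord_ofCoord hs _)
    exact h.change_chart hγ.continuous.continuousAt ht.2.self_of_nhds (mem_extChartAt_source _)

theorem exists_isParallelAlong (hγ : ContMDiff 𝓘(ℝ, ℝ) (𝓡 d) 1 γ) (a : ℝ)
    (u : TangentSpace (𝓡 d) (γ a)) : ∃ V, V a = u ∧ IsParallelAlong γ V := by
  obtain ⟨V, hVa, hV⟩ := (isUniqueLocalCondition_isParallelIn hγ.continuous).exists_global
    (exists_nhds_forall_exists_isParallelIn hγ) a u
  exact ⟨V, hVa, isParallelAlong_iff.2 fun t => ⟨hγ.mdifferentiable one_ne_zero t, hV t⟩⟩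

namespace IsParallelAlong

lemma inner_eq (hV : IsParallelAlong γ V) (hW : IsParallelAlong γ W) (a b : ℝ) :
    inner ℝ (V a) (W a) = inner ℝ (V b) (W b) := by
  have h := fun t => (isParallelAlong_iff.1 hV t).2.hasDerivAt_inner
    (isParallelAlong_iff.1 hW t).2 (hV.mdifferentiable.continuous.continuousAt)
    (mem_extChartAt_source _)
  exact is_const_of_deriv_eq_zero (fun t => (h t).differentiableAt) (fun t => (h t).deriv) a b

lemma norm_eq (hV : IsParallelAlong γ V) (a b : ℝ) : ‖V a‖ = ‖V b‖ := by
  rw [norm_eq_sqrt_real_inner (V a), norm_eq_sqrt_real_inner (V b), hV.inner_eq hV a b]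

lemma add (hV : IsParallelAlong γ V) (hW : IsParallelAlong γ W) :
    IsParallelAlong γ (fun t => V t + W t) :=
  isParallelAlong_iff.2 fun t =>
    ⟨hV.mdifferentiable t, (isParallelAlong_iff.1 hV t).2.add (isParallelAlong_iff.1 hW t).2⟩

lemma const_smul (hV : IsParallelAlong γ V) (a : ℝ) : IsParallelAlong γ (fun t => a • V t) :=
  isParallelAlong_iff.2 fun t =>
    ⟨hV.mdifferentiable t, (isParallelAlong_iff.1 hV t).2.const_smul a⟩

lemma eq_of_eq (hV : IsParallelAlong γ V) (hW : IsParallelAlong γ W) {a : ℝ} (h : V a = W a)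
    (b : ℝ) : V b = W b :=
  (isUniqueLocalCondition_isParallelIn hV.mdifferentiable.continuous).unique isOpen_univ
    Set.ordConnected_univ (fun t _ => (isParallelAlong_iff.1 hV t).2)
    (fun t _ => (isParallelAlong_iff.1 hW t).2) (Set.mem_univ a) h (Set.mem_univ b)

lemma comp_mul (hV : IsParallelAlong γ V) (r : ℝ) :
    IsParallelAlong (fun s => γ (r * s)) (fun s => V (r * s)) :=
  isParallelAlong_iff.2 fun t =>
    ⟨(hV.mdifferentiable (r * t)).comp t
        (differentiableAt_id.const_mul r).mdifferentiableAt,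
      IsParallelAt.comp_mul (isParallelAlong_iff.1 hV (r * t)).2⟩

lemma parallelTransport_eq (hV : IsParallelAlong γ V) (a b : ℝ) :
    parallelTransport γ a b ⟨γ a, V a⟩ = V b := by
  have h : ∃ W, IsParallelAlong γ W ∧ (⟨γ a, W a⟩ : TangentBundle (𝓡 d) M) = ⟨γ a, V a⟩ :=
    ⟨V, hV, rfl⟩
  rw [parallelTransport, dif_pos h]
  exact h.choose_spec.1.eq_of_eq hV (TotalSpace.mk_injective _ h.choose_spec.2) b

end IsParallelAlong

end ParallelFields

section Geodesics

variable {d : ℕ} {M : Type*} [TopologicalSpace M]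
  [ChartedSpace (EuclideanSpace ℝ (Fin d)) M]

lemma velocity_comp_mul {γ : ℝ → M} {r t : ℝ}
    (hγ : MDifferentiableAt 𝓘(ℝ, ℝ) (𝓡 d) γ (r * t)) :
    velocity (d := d) (fun s => γ (r * s)) t = r • velocity (d := d) γ (r * t) := by
  have hr : HasDerivAt (fun s : ℝ => r * s) r t := by simpa using (hasDerivAt_id t).const_mul r
  have h := (hγ.hasMFDerivAt.comp t hr.hasFDerivAt.hasMFDerivAt).mfderiv
  refine (DFunLike.congr_fun h (1 : ℝ)).trans
    (.trans ?_ (map_smul (mfderiv 𝓘(ℝ, ℝ) (𝓡 d) γ (r * t)) r (1 : ℝ)))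
  exact congrArg (mfderiv 𝓘(ℝ, ℝ) (𝓡 d) γ (r * t)) (one_smul ℝ r |>.trans (mul_one r).symm)

variable [IsManifold (𝓡 d) ∞ M] [RiemannianBundle (fun x : M => TangentSpace (𝓡 d) x)]
  [IsContMDiffRiemannianBundle (𝓡 d) 1 (EuclideanSpace ℝ (Fin d))
    (fun x : M => TangentSpace (𝓡 d) x)] {γ : ℝ → M}

namespace IsGeodesic

lemma comp_mul (hγ : IsGeodesic (d := d) γ) (r : ℝ) :
    IsGeodesic (d := d) (fun s => γ (r * s)) := by
  have hvel : velocity (d := d) (fun s => γ (r * s)) = fun s => r • velocity γ (r * s) :=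
    funext fun s => velocity_comp_mul (hγ.mdifferentiable (r * s))
  rw [IsGeodesic, hvel]
  exact (IsParallelAlong.comp_mul hγ r).const_smul r

lemma contMDiff (hγ : IsGeodesic (d := d) γ) : ContMDiff 𝓘(ℝ, ℝ) (𝓡 d) 1 γ := by
  intro t
  have hcont := hγ.mdifferentiable.continuous.continuousAt (x := t)
  have hsource : ∀ᶠ s in 𝓝 t, γ s ∈ (extChartAt (𝓡 d) (γ t)).source :=
    hcont.preimage_mem_nhds (extChartAt_source_mem_nhds _)
  have hderiv : ∀ᶠ s in 𝓝 t, HasDerivAt (fun s => extChartAt (𝓡 d) (γ t) (γ s))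
      (toCoord (γ t) (γ s) (velocity γ s)) s :=
    hsource.mono fun s hs => hasDerivAt_extChartAt_comp (hγ.mdifferentiable s) hs
  have hvel : ∀ᶠ s in 𝓝 t, ContinuousAt
      (fun s => toCoord (d := d) (γ t) (γ s) (velocity γ s)) s := by
    filter_upwards [hsource] with s hs
    obtain ⟨_, _, _, hv, _⟩ := (isParallelAlong_iff.1 hγ s).2.change_chart
      hγ.mdifferentiable.continuous.continuousAt (mem_extChartAt_source _) hs
    exact hv.continuousAt
  refine contMDiffAt_iff_target.2 ⟨hcont, (contDiffAt_one_iff.2 ⟨fun s =>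
    ContinuousLinearMap.toSpanSingleton ℝ (toCoord (γ t) (γ s) (velocity γ s)), _,
    hderiv.and hvel, fun s hs => ?_, fun s hs => hs.1.hasFDerivAt⟩).contMDiffAt⟩
  exact ((ContinuousLinearMap.toSpanSingletonCLE (𝕜 := ℝ)
    (E := EuclideanSpace ℝ (Fin d))).continuous.continuousAt.comp
    hs.2).continuousWithinAt

end IsGeodesic

end Geodesics

section Transport

section Exp

variable {d : ℕ} {M : Type*} [TopologicalSpace M]
  [ChartedSpace (EuclideanSpace ℝ (Fin d)) M] [IsManifold (𝓡 d) ∞ M]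
  [RiemannianBundle (fun x : M => TangentSpace (𝓡 d) x)]

lemma isGeodesic_geodesic (hM : GeodesicallyComplete d M) (x : M) (v : TangentSpace (𝓡 d) x) :
    IsGeodesic (d := d) (geodesic x v) := by
  rw [geodesic, dif_pos (hM x v)]
  exact (hM x v).choose_spec.1

lemma geodesic_mk_velocity_zero (hM : GeodesicallyComplete d M) (x : M)
    (v : TangentSpace (𝓡 d) x) :
    (⟨geodesic x v 0, velocity (geodesic x v) 0⟩ : TangentBundle (𝓡 d) M) = ⟨x, v⟩ := by
  rw [geodesic, dif_pos (hM x v)]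
  exact (hM x v).choose_spec.2

end Exp

variable {d : ℕ} {M : Type*} [TopologicalSpace M]
  [ChartedSpace (EuclideanSpace ℝ (Fin d)) M] [IsManifold (𝓡 d) ∞ M]
  [RiemannianBundle (fun x : M => TangentSpace (𝓡 d) x)]
  [IsContMDiffRiemannianBundle (𝓡 d) 1 (EuclideanSpace ℝ (Fin d))
    (fun x : M => TangentSpace (𝓡 d) x)]

/-- Parallel transport along a `C¹` curve from time `a` to time `b`, as a linear isometry. The
starting point is a variable `x` so that it need not be definitionally `γ a`. -/
def parallelTransportₗᵢ {γ : ℝ → M} (hγ : ContMDiff 𝓘(ℝ, ℝ) (𝓡 d) 1 γ) (a b : ℝ) {x : M}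
    (hx : γ a = x) : TangentSpace (𝓡 d) x →ₗᵢ[ℝ] TangentSpace (𝓡 d) (γ b) where
  toFun u := parallelTransport γ a b ⟨x, u⟩
  map_add' u w := by
    obtain rfl := hx
    obtain ⟨U, rfl, hU⟩ := exists_isParallelAlong hγ a u
    obtain ⟨W, rfl, hW⟩ := exists_isParallelAlong hγ a w
    rw [(hU.add hW).parallelTransport_eq, hU.parallelTransport_eq, hW.parallelTransport_eq]
  map_smul' r u := by
    obtain rfl := hx
    obtain ⟨U, rfl, hU⟩ := exists_isParallelAlong hγ a u
    rw [(hU.const_smul r).parallelTransport_eq, hU.parallelTransport_eq, RingHom.id_apply]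
  norm_map' u := by
    obtain rfl := hx
    obtain ⟨U, rfl, hU⟩ := exists_isParallelAlong hγ a u
    change ‖parallelTransport γ a b ⟨γ a, U a⟩‖ = ‖U a‖
    rw [hU.parallelTransport_eq, hU.norm_eq]

/-- Parallel transport along `t ↦ Exp_x(t v)`, as a linear isometry. -/
def expTransportₗᵢ (hM : GeodesicallyComplete d M) (x : M) (v : TangentSpace (𝓡 d) x) :
    TangentSpace (𝓡 d) x →ₗᵢ[ℝ] TangentSpace (𝓡 d) (riemExp x v) :=
  parallelTransportₗᵢ (isGeodesic_geodesic hM x v).contMDiff 0 1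
    (congrArg TotalSpace.proj (geodesic_mk_velocity_zero hM x v))

lemma expTransport_eq (hM : GeodesicallyComplete d M) (x : M) (v u : TangentSpace (𝓡 d) x) :
    expTransport x v u = expTransportₗᵢ hM x v u := rfl

end Transport

section Gradients

variable {d : ℕ} {M : Type*} [TopologicalSpace M]
  [ChartedSpace (EuclideanSpace ℝ (Fin d)) M]
  [RiemannianBundle (fun x : M => TangentSpace (𝓡 d) x)] {f : M → ℝ} {γ : ℝ → M}

lemma completeSpace_tangentSpace (x : M) : CompleteSpace (TangentSpace (𝓡 d) x) :=
  have : FiniteDimensional ℝ (TangentSpace (𝓡 d) x) :=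
    inferInstanceAs (FiniteDimensional ℝ (EuclideanSpace ℝ (Fin d)))
  FiniteDimensional.complete ℝ _

lemma inner_riemGrad (f : M → ℝ) (x : M) (v : TangentSpace (𝓡 d) x) :
    inner ℝ (riemGrad f x) v = mvfderiv (𝓡 d) f x v :=
  have := completeSpace_tangentSpace (d := d) x
  InnerProductSpace.toDual_symm_apply

lemma hasDerivAt_comp_curve {t : ℝ} (hf : MDifferentiableAt (𝓡 d) 𝓘(ℝ, ℝ) f (γ t))
    (hγ : MDifferentiableAt 𝓘(ℝ, ℝ) (𝓡 d) γ t) :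
    HasDerivAt (fun s => f (γ s)) (inner ℝ (riemGrad f (γ t)) (velocity (d := d) γ t)) t := by
  rw [inner_riemGrad]
  have h := (hf.comp t hγ).differentiableAt.hasFDerivAt.hasDerivAt
  rw [← mfderiv_eq_fderiv, mfderiv_comp t hf hγ] at h
  exact h

lemma le_quadratic_of_deriv_le {g g' : ℝ → ℝ} {a b : ℝ} (hg : ∀ t, HasDerivAt g (g' t) t)
    (hbound : ∀ t, 0 ≤ t → g' t ≤ a + b * t) : g 1 ≤ g 0 + a + b / 2 := by
  have hB : ∀ t, HasDerivAt (fun t => g 0 + a * t + b / 2 * t ^ 2) (a + b * t) t := fun t => by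
    refine ((((hasDerivAt_id t).const_mul a).const_add (g 0)).add
      ((hasDerivAt_pow 2 t).const_mul (b / 2))).congr_deriv ?_
    norm_num
    ring
  have h := image_le_of_deriv_right_le_deriv_boundary (a := 0) (b := 1)
    (fun t _ => (hg t).continuousAt.continuousWithinAt) (fun t _ => (hg t).hasDerivWithinAt)
    (by simp) (fun t _ => (hB t).continuousAt.continuousWithinAt)
    (fun t _ => (hB t).hasDerivWithinAt) (fun t ht => hbound t ht.1)
    (Set.right_mem_Icc.2 zero_le_one)
  simpa using h

variable [IsManifold (𝓡 d) ∞ M] [IsContMDiffRiemannianBundle (𝓡 d) 1 (EuclideanSpace ℝ (Fin d))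
  (fun x : M => TangentSpace (𝓡 d) x)] {L : ℝ}

namespace IsGSmooth

lemma norm_riemGrad_sub_le (hf : IsGSmooth d L f) (hγ : IsGeodesic (d := d) γ) {t : ℝ}
    (ht : 0 ≤ t) {V : ∀ t, TangentSpace (𝓡 d) (γ t)} (hV : IsParallelAlong γ V)
    (hVt : V t = riemGrad f (γ t)) :
    ‖riemGrad f (γ 0) - V 0‖ ≤ L * (t * ‖velocity (d := d) γ 0‖) := by
  have h := hf.2 _ (hγ.comp_mul t)
  have hV₁ : riemGrad f (γ (t * 1)) = V (t * 1) := by rw [mul_one, hVt]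
  rw [hV₁, (hV.comp_mul t).parallelTransport_eq 1 0, velocity_comp_mul (hγ.mdifferentiable _),
    norm_smul, mul_zero, Real.norm_of_nonneg ht] at h
  exact h

lemma inner_riemGrad_velocity_le (hf : IsGSmooth d L f) (hγ : IsGeodesic (d := d) γ) {t : ℝ}
    (ht : 0 ≤ t) :
    inner ℝ (riemGrad f (γ t)) (velocity (d := d) γ t)
      ≤ inner ℝ (riemGrad f (γ 0)) (velocity (d := d) γ 0)
        + L * ‖velocity (d := d) γ 0‖ ^ 2 * t := by
  obtain ⟨V, hVt, hV⟩ := exists_isParallelAlong hγ.contMDiff t (riemGrad f (γ t))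
  have hgrad := hf.norm_riemGrad_sub_le hγ ht hV hVt
  calc inner ℝ (riemGrad f (γ t)) (velocity (d := d) γ t)
      = inner ℝ (V 0) (velocity (d := d) γ 0) := by rw [← hVt, hV.inner_eq hγ t 0]
    _ = inner ℝ (riemGrad f (γ 0)) (velocity (d := d) γ 0)
        + inner ℝ (V 0 - riemGrad f (γ 0)) (velocity (d := d) γ 0) := by
      rw [← inner_add_left, add_sub_cancel]
    _ ≤ inner ℝ (riemGrad f (γ 0)) (velocity (d := d) γ 0)
        + L * (t * ‖velocity (d := d) γ 0‖) * ‖velocity (d := d) γ 0‖ := by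
      rw [norm_sub_rev] at hgrad
      grw [real_inner_le_norm (V 0 - riemGrad f (γ 0)), hgrad]
    _ = _ := by ring

lemma le_of_isGeodesic (hf : IsGSmooth d L f) (hγ : IsGeodesic (d := d) γ) :
    f (γ 1) ≤ f (γ 0) + inner ℝ (riemGrad f (γ 0)) (velocity (d := d) γ 0)
      + L * ‖velocity (d := d) γ 0‖ ^ 2 / 2 :=
  le_quadratic_of_deriv_le (fun t => hasDerivAt_comp_curve (d := d) (hf.1 _) (hγ.mdifferentiable t))
    fun _ ht => hf.inner_riemGrad_velocity_le hγ ht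

lemma norm_riemGrad_sub_parallelTransport_le (hf : IsGSmooth d L f) (hγ : IsGeodesic (d := d) γ) :
    ‖riemGrad f (γ 1) - parallelTransport (d := d) γ 0 1 ⟨γ 0, riemGrad f (γ 0)⟩‖
      ≤ L * ‖velocity (d := d) γ 0‖ := by
  obtain ⟨V, hV₁, hV⟩ := exists_isParallelAlong hγ.contMDiff 1 (riemGrad f (γ 1))
  obtain ⟨W, hW₀, hW⟩ := exists_isParallelAlong hγ.contMDiff 0 (riemGrad f (γ 0))
  have hgrad := hf.norm_riemGrad_sub_le hγ zero_le_one hV hV₁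
  rw [← hW₀, norm_sub_rev, one_mul] at hgrad
  rw [← hV₁, ← hW₀, hW.parallelTransport_eq]
  have hnorm := (hV.add (hW.const_smul (-1))).norm_eq 1 0
  simp only [neg_one_smul, ← sub_eq_add_neg] at hnorm
  exact hnorm.trans_le hgrad

variable {x : M} {v : TangentSpace (𝓡 d) x}

lemma riemExp_le (hf : IsGSmooth d L f) (hM : GeodesicallyComplete d M) :
    f (riemExp x v) ≤ f x + inner ℝ (riemGrad f x) v + L * ‖v‖ ^ 2 / 2 := by
  have hγ := isGeodesic_geodesic hM x v
  have h := geodesic_mk_velocity_zero hM x v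
  unfold riemExp
  generalize geodesic x v = γ at *
  obtain rfl : γ 0 = x := congrArg TotalSpace.proj h
  obtain rfl : velocity γ 0 = v := TotalSpace.mk_injective _ h
  exact hf.le_of_isGeodesic hγ

lemma norm_riemGrad_sub_expTransport_le (hf : IsGSmooth d L f) (hM : GeodesicallyComplete d M) :
    ‖riemGrad f (riemExp x v) - expTransport x v (riemGrad f x)‖ ≤ L * ‖v‖ := by
  have hγ := isGeodesic_geodesic hM x v
  have h := geodesic_mk_velocity_zero hM x v
  unfold expTransport riemExp
  generalize geodesic x v = γ at *
  obtain rfl : γ 0 = x := congrArg TotalSpace.proj h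
  obtain rfl : velocity γ 0 = v := TotalSpace.mk_injective _ h
  exact hf.norm_riemGrad_sub_parallelTransport_le hγ

end IsGSmooth

end Gradients

section LowerIntegral

lemma lintegral_pi_insertNth_le {k : ℕ} {α : Fin (k + 1) → Type*} [∀ j, MeasurableSpace (α j)]
    (μ : ∀ j, Measure (α j)) [∀ j, SigmaFinite (μ j)] (i : Fin (k + 1))
    (F : (∀ j, α j) → ℝ≥0∞) :
    ∫⁻ r, F r ∂(Measure.pi μ)
      ≤ ∫⁻ a, ∫⁻ r, F (i.insertNth a r) ∂(Measure.pi fun j => μ (i.succAbove j)) ∂(μ i) := by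
  have h := (measurePreserving_piFinSuccAbove μ i).symm
  rw [← h.map_eq, lintegral_map_equiv]
  exact lintegral_prod_le _

lemma lintegral_pi_eval_le {n : ℕ} {α : Fin n → Type*} [∀ j, MeasurableSpace (α j)]
    (μ : ∀ j, Measure (α j)) [∀ j, IsProbabilityMeasure (μ j)] (i : Fin n) (g : α i → ℝ≥0∞) :
    ∫⁻ r, g (r i) ∂(Measure.pi μ) ≤ ∫⁻ a, g a ∂(μ i) := by
  obtain ⟨k, rfl⟩ := Nat.exists_eq_add_one.2 i.pos
  refine (lintegral_pi_insertNth_le μ i _).trans ?_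
  simp

lemma lintegral_bernoulliMeasure (p : unitInterval) (g : Bool → ℝ≥0∞) :
    ∫⁻ b, g b ∂(bernoulliMeasure true false p)
      = ENNReal.ofReal p * g true + ENNReal.ofReal (1 - p) * g false := by
  have hp (q : unitInterval) : ENNReal.ofReal q = unitInterval.toNNReal q :=
    ENNReal.ofReal_eq_coe_nnreal q.2.1
  rw [bernoulliMeasure_def, lintegral_add_measure, lintegral_smul_measure, lintegral_smul_measure,
    lintegral_dirac, lintegral_dirac, ← unitInterval.coe_symm_eq, hp, hp]
  rfl

lemma lintegral_uniformOn_univ {ι : Type*} [Fintype ι] [MeasurableSpace ι]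
    [MeasurableSingletonClass ι] (g : ι → ℝ≥0∞) :
    ∫⁻ k, g k ∂(uniformOn (Set.univ : Set ι)) = (Fintype.card ι : ℝ≥0∞)⁻¹ * ∑ k, g k := by
  rw [uniformOn, ProbabilityTheory.cond, Measure.restrict_univ, lintegral_smul_measure,
    lintegral_count, tsum_fintype, Measure.count_univ]
  simp

end LowerIntegral

section Run

variable {σ R : Type*}

/-- The state after `k` rounds of a random recursion started at a given state. The recursion is on
the first round, so that bounds can be proved by conditioning on it. -/
def runFrom (next : σ → R → σ) : (k : ℕ) → σ → (Fin k → R) → σ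
  | 0, st, _ => st
  | k + 1, st, r => runFrom next k (next st (r 0)) (Fin.tail r)

lemma runFrom_succ_last (next : σ → R → σ) (k : ℕ) (st : σ) (r : Fin (k + 1) → R) :
    runFrom next (k + 1) st r = next (runFrom next k st (Fin.init r)) (r (Fin.last k)) := by
  induction k generalizing st with
  | zero => rfl
  | succ k ih =>
    rw [runFrom, ih]
    rfl

-- No measurability is needed, since the lower integral over a run is at most the iterated one.
lemma lintegral_sum_runFrom_le [MeasurableSpace R] (μ : Measure R) [IsProbabilityMeasure μ]
    (next : σ → R → σ) (c : σ → R → ℝ≥0∞) (Φ : ℕ → σ → ℝ≥0∞)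
    (hstep : ∀ K st, ∫⁻ a, (c st a + Φ K (next st a)) ∂μ ≤ Φ (K + 1) st) (K : ℕ) (st : σ) :
    ∫⁻ r, ∑ k : Fin K, c (runFrom next k st fun j => r (Fin.castLE k.is_lt.le j)) (r k)
      ∂(Measure.pi fun _ => μ) ≤ Φ K st := by
  induction K generalizing st with
  | zero => simp
  | succ K ih =>
    refine (lintegral_pi_insertNth_le (fun _ => μ) 0 _).trans
      ((lintegral_mono fun a => ?_).trans (hstep K st))
    calc ∫⁻ r : Fin K → R, ∑ k : Fin (K + 1),
          c (runFrom next k st fun j => (Fin.insertNth 0 a r : Fin (K + 1) → R)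
            (Fin.castLE k.is_lt.le j)) ((Fin.insertNth 0 a r : Fin (K + 1) → R) k)
            ∂(Measure.pi fun _ => μ)
        = ∫⁻ r : Fin K → R, (c st a + ∑ k : Fin K,
            c (runFrom next k (next st a) fun j => r (Fin.castLE k.is_lt.le j)) (r k))
            ∂(Measure.pi fun _ => μ) :=
          lintegral_congr fun r => by
            rw [Fin.insertNth_zero', Fin.sum_univ_succ]
            rfl
      _ = c st a + ∫⁻ r : Fin K → R, ∑ k : Fin K,
            c (runFrom next k (next st a) fun j => r (Fin.castLE k.is_lt.le j)) (r k)
            ∂(Measure.pi fun _ => μ) := by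
          rw [lintegral_add_left measurable_const, lintegral_const, measure_univ, mul_one]
      _ ≤ c st a + Φ K (next st a) := by grw [ih]

end Run

section SecondMoment

lemma enorm_sq_eq_ofReal {H : Type*} [SeminormedAddCommGroup H] (x : H) :
    ‖x‖ₑ ^ 2 = ENNReal.ofReal (‖x‖ ^ 2) := by
  rw [← ofReal_norm, ENNReal.ofReal_pow (norm_nonneg _)]

lemma memLp_two_of_lintegral_ne_top {S H : Type*} [MeasurableSpace S] {ν : Measure S}
    [NormedAddCommGroup H] {Z : S → H} (hZ : AEStronglyMeasurable Z ν)
    (h : ∫⁻ s, ‖Z s‖ₑ ^ 2 ∂ν ≠ ⊤) : MemLp Z 2 ν := by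
  refine ⟨hZ,
    (eLpNorm_lt_top_iff_lintegral_rpow_enorm_lt_top two_ne_zero ENNReal.ofNat_ne_top).2 ?_⟩
  simpa using h.lt_top

lemma lintegral_enorm_sq_eq_ofReal {S H : Type*} [MeasurableSpace S] {ν : Measure S}
    [NormedAddCommGroup H] {Z : S → H} (hZ : MemLp Z 2 ν) :
    ∫⁻ s, ‖Z s‖ₑ ^ 2 ∂ν = ENNReal.ofReal (∫ s, ‖Z s‖ ^ 2 ∂ν) := by
  rw [ofReal_integral_eq_lintegral_ofReal (hZ.integrable_norm_pow two_ne_zero)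
    (.of_forall fun s => sq_nonneg _)]
  simp only [enorm_sq_eq_ofReal]

variable {H : Type*} [NormedAddCommGroup H] [InnerProductSpace ℝ H] [CompleteSpace H]

lemma lintegral_enorm_const_add_sq {S : Type*} [MeasurableSpace S] {ν : Measure S}
    [IsProbabilityMeasure ν] {Z : S → H} (hZ : MemLp Z 2 ν) (hmean : ∫ s, Z s ∂ν = 0) (a : H) :
    ∫⁻ s, ‖a + Z s‖ₑ ^ 2 ∂ν = ‖a‖ₑ ^ 2 + ∫⁻ s, ‖Z s‖ₑ ^ 2 ∂ν := by
  have hint : Integrable Z ν := hZ.integrable one_le_two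
  have hsq : Integrable (fun s => ‖Z s‖ ^ 2) ν := hZ.integrable_norm_pow two_ne_zero
  have hcross : Integrable (fun s => 2 * inner ℝ a (Z s)) ν := (hint.const_inner a).const_mul 2
  have hreal : ∫ s, ‖a + Z s‖ ^ 2 ∂ν = ‖a‖ ^ 2 + ∫ s, ‖Z s‖ ^ 2 ∂ν := by
    simp only [norm_add_sq_real]
    rw [integral_add (by fun_prop) hsq, integral_add (by fun_prop) hcross, integral_const_mul,
      integral_inner hint, hmean]
    simp
  rw [lintegral_enorm_sq_eq_ofReal (Z := fun s => a + Z s) ((memLp_const a).add hZ),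
    lintegral_enorm_sq_eq_ofReal hZ, hreal,
    ENNReal.ofReal_add (by positivity) (by positivity), enorm_sq_eq_ofReal]

lemma lintegral_enorm_const_add_sum_sq_le {n : ℕ} {S : Fin n → Type*}
    [∀ i, MeasurableSpace (S i)] {ν : ∀ i, Measure (S i)} [∀ i, IsProbabilityMeasure (ν i)]
    {Z : ∀ i, S i → H} (hZ : ∀ i, MemLp (Z i) 2 (ν i)) (hmean : ∀ i, ∫ s, Z i s ∂(ν i) = 0)
    (a : H) :
    ∫⁻ s, ‖a + ∑ i, Z i (s i)‖ₑ ^ 2 ∂(Measure.pi ν)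
      ≤ ‖a‖ₑ ^ 2 + ∑ i, ∫⁻ s, ‖Z i s‖ₑ ^ 2 ∂(ν i) := by
  induction n generalizing a with
  | zero => simp
  | succ n ih =>
    refine (lintegral_pi_insertNth_le ν 0 _).trans ?_
    simp only [Fin.sum_univ_succ, ← add_assoc]
    calc ∫⁻ s₀, ∫⁻ s, ‖a + Z 0 s₀ + ∑ i, Z i.succ (s i)‖ₑ ^ 2
            ∂(Measure.pi fun i => ν (Fin.succAbove 0 i)) ∂(ν 0)
        ≤ ∫⁻ s₀, (‖a + Z 0 s₀‖ₑ ^ 2 + ∑ i : Fin n, ∫⁻ s, ‖Z i.succ s‖ₑ ^ 2 ∂(ν i.succ)) ∂(ν 0) :=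
          lintegral_mono fun s₀ => ih (fun i => hZ i.succ) (fun i => hmean i.succ) (a + Z 0 s₀)
      _ = ‖a‖ₑ ^ 2 + ∫⁻ s, ‖Z 0 s‖ₑ ^ 2 ∂(ν 0)
            + ∑ i : Fin n, ∫⁻ s, ‖Z i.succ s‖ₑ ^ 2 ∂(ν i.succ) := by
          rw [lintegral_add_right _ measurable_const, lintegral_const, measure_univ, mul_one,
            lintegral_enorm_const_add_sq (hZ 0) (hmean 0)]

lemma lintegral_enorm_const_add_avg_sq_le {n : ℕ} {S : Fin n → Type*}
    [∀ i, MeasurableSpace (S i)] {ν : ∀ i, Measure (S i)} [∀ i, IsProbabilityMeasure (ν i)]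
    {Z : ∀ i, S i → H} (hZ : ∀ i, MemLp (Z i) 2 (ν i)) (hmean : ∀ i, ∫ s, Z i s ∂(ν i) = 0)
    {v : ℝ≥0∞} (hvar : ∀ i, ∫⁻ s, ‖Z i s‖ₑ ^ 2 ∂(ν i) ≤ v) (a : H) :
    ∫⁻ s, ‖a + (n : ℝ)⁻¹ • ∑ i, Z i (s i)‖ₑ ^ 2 ∂(Measure.pi ν) ≤ ‖a‖ₑ ^ 2 + v / n := by
  rcases Nat.eq_zero_or_pos n with rfl | hn
  · simp
  have hinv : ‖(n : ℝ)⁻¹‖ₑ = (n : ℝ≥0∞)⁻¹ := by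
    rw [enorm_inv (Nat.cast_ne_zero.2 hn.ne'), Real.enorm_natCast]
  have hmean' (i : Fin n) : ∫ s, (n : ℝ)⁻¹ • Z i s ∂(ν i) = 0 := by
    rw [integral_smul, hmean, smul_zero]
  have hvar' (i : Fin n) : ∫⁻ s, ‖(n : ℝ)⁻¹ • Z i s‖ₑ ^ 2 ∂(ν i) ≤ (n : ℝ≥0∞)⁻¹ ^ 2 * v := by
    simp only [enorm_smul, mul_pow]
    rw [lintegral_const_mul' _ _ (by simp), hinv]
    grw [hvar i]
  simp only [Finset.smul_sum]
  refine (lintegral_enorm_const_add_sum_sq_le (Z := fun i s => (n : ℝ)⁻¹ • Z i s)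
    (fun i => (hZ i).const_smul (n : ℝ)⁻¹) hmean' a).trans ?_
  grw [Finset.sum_le_sum fun i _ => hvar' i]
  rw [Finset.sum_const, Finset.card_univ, Fintype.card_fin, nsmul_eq_mul, sq (n : ℝ≥0∞)⁻¹,
    mul_assoc, ENNReal.mul_inv_cancel_left (Nat.cast_ne_zero.2 hn.ne') (ENNReal.natCast_ne_top n),
    ENNReal.div_eq_inv_mul]

end SecondMoment

section Compressor

variable {d : ℕ} {M : Type*} [TopologicalSpace M]
  [ChartedSpace (EuclideanSpace ℝ (Fin d)) M] [IsManifold (𝓡 d) ∞ M]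
  {S : Type*} [MeasurableSpace S] {ν : Measure S}

section Density

variable [IsProbabilityMeasure ν] {n : ℕ}

lemma ofReal_expectedDensity (b : MeasurableFrame d M)
    (Q : Fin n → S → ∀ x : M, TangentSpace (𝓡 d) x → TangentSpace (𝓡 d) x) :
    ENNReal.ofReal (expectedDensity b ν Q) = ⨆ (i : Fin n) (x : M) (y : TangentSpace (𝓡 d) x),
      ∫⁻ s, (b.nnz (Q i s x y) : ℝ≥0∞) ∂ν := by
  refine ENNReal.ofReal_toReal (ne_top_of_le_ne_top (ENNReal.natCast_ne_top d) ?_)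
  refine iSup_le fun i => iSup_le fun x => iSup_le fun y => ?_
  calc ∫⁻ s, (b.nnz (Q i s x y) : ℝ≥0∞) ∂ν ≤ ∫⁻ _, (d : ℝ≥0∞) ∂ν :=
        lintegral_mono fun s =>
          Nat.cast_le.2 ((Finset.card_le_univ _).trans_eq (Fintype.card_fin d))
    _ = d := by simp

lemma lintegral_nnz_le (b : MeasurableFrame d M)
    (Q : Fin n → S → ∀ x : M, TangentSpace (𝓡 d) x → TangentSpace (𝓡 d) x) (i : Fin n) (x : M)
    (y : TangentSpace (𝓡 d) x) :
    ∫⁻ s, (b.nnz (Q i s x y) : ℝ≥0∞) ∂ν ≤ ENNReal.ofReal (expectedDensity b ν Q) := by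
  rw [ofReal_expectedDensity]
  exact le_iSup_of_le i (le_iSup_of_le x (le_iSup_of_le y le_rfl))

end Density

variable [RiemannianBundle (fun x : M => TangentSpace (𝓡 d) x)] {ωQ : ℝ}
  {q : S → ∀ x : M, TangentSpace (𝓡 d) x → TangentSpace (𝓡 d) x}

namespace IsUnbiasedCompressor

lemma stronglyMeasurable (hq : IsUnbiasedCompressor ν ωQ q) (x : M) (y : TangentSpace (𝓡 d) x) :
    StronglyMeasurable (fun s => q s x y) := by
  borelize (TangentSpace (𝓡 d) x)
  borelize (TangentBundle (𝓡 d) M)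
  have : SecondCountableTopology (TangentSpace (𝓡 d) x) :=
    inferInstanceAs (SecondCountableTopology (EuclideanSpace ℝ (Fin d)))
  have hborel : borel (TangentSpace (𝓡 d) x)
      = (borel (TangentBundle (𝓡 d) M)).comap (TotalSpace.mk x) := by
    rw [← borel_comap, ← (FiberBundle.totalSpaceMk_isInducing (EuclideanSpace ℝ (Fin d))
      (fun x : M => TangentSpace (𝓡 d) x) x).eq_induced]
  have hmeas : Measurable[_, borel _] (fun s => q s x y) := by
    rw [hborel, measurable_comap_iff]
    exact hq.measurable.comp (measurable_id.prodMk (measurable_const (a := ⟨x, y⟩)))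
  exact hmeas.stronglyMeasurable

lemma memLp_sub (hq : IsUnbiasedCompressor ν ωQ q) (x : M) (y : TangentSpace (𝓡 d) x) :
    MemLp (fun s => q s x y - y) 2 ν :=
  memLp_two_of_lintegral_ne_top
    ((hq.stronglyMeasurable x y).sub stronglyMeasurable_const).aestronglyMeasurable
    (ne_top_of_le_ne_top ENNReal.ofReal_ne_top (hq.variance x y))

lemma integral_sub_eq_zero [IsProbabilityMeasure ν] (hq : IsUnbiasedCompressor ν ωQ q) (x : M)
    (y : TangentSpace (𝓡 d) x) : ∫ s, (q s x y - y) ∂ν = 0 := by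
  have := completeSpace_tangentSpace (d := d) x
  have hint : Integrable (fun s => q s x y) ν := by
    have h := (hq.memLp_sub x y).integrable one_le_two
    exact (h.add (integrable_const y)).congr (.of_forall fun s => sub_add_cancel _ _)
  rw [integral_sub hint (integrable_const y), hq.unbiased, integral_const, probReal_univ,
    one_smul, sub_self]

lemma measure_support_le_lintegral_nnz (hq : IsUnbiasedCompressor ν ωQ q)
    (b : MeasurableFrame d M) (x : M) (y : TangentSpace (𝓡 d) x) :
    ν (Function.support fun s => q s x y) ≤ ∫⁻ s, (b.nnz (q s x y) : ℝ≥0∞) ∂ν := by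
  rw [← lintegral_indicator_one (hq.stronglyMeasurable x y).measurableSet_support]
  refine lintegral_mono (Set.indicator_le fun s hs => ?_)
  have hnnz : b.nnz (q s x y) ≠ 0 := by
    rw [MeasurableFrame.nnz, Finset.card_ne_zero, Finsupp.support_nonempty_iff]
    simpa using hs
  exact Nat.one_le_cast.2 (Nat.one_le_iff_ne_zero.2 hnnz)

lemma lintegral_nnz_ne_zero (hq : IsUnbiasedCompressor ν ωQ q) (b : MeasurableFrame d M) {x : M}
    {y : TangentSpace (𝓡 d) x} (hy : y ≠ 0) : ∫⁻ s, (b.nnz (q s x y) : ℝ≥0∞) ∂ν ≠ 0 := by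
  intro h
  have hzero : (fun s => q s x y) =ᵐ[ν] 0 :=
    ae_iff.2 (le_antisymm (h ▸ hq.measure_support_le_lintegral_nnz b x y) zero_le)
  have hmean := hq.unbiased x y
  rw [integral_congr_ae hzero] at hmean
  exact hy (by simpa using hmean.symm)

end IsUnbiasedCompressor

lemma lintegral_enorm_const_add_avg_sub_sq_le [IsProbabilityMeasure ν] {n : ℕ}
    {Q : Fin n → S → ∀ x : M, TangentSpace (𝓡 d) x → TangentSpace (𝓡 d) x} (hn : 0 < n)
    (hQ : ∀ i, IsUnbiasedCompressor ν ωQ (Q i)) {x : M} {y : Fin n → TangentSpace (𝓡 d) x} {D : ℝ}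
    (hy : ∀ i, ‖y i‖ ≤ D) (a : TangentSpace (𝓡 d) x) :
    ∫⁻ s, ‖a + (n : ℝ)⁻¹ • ∑ i, (Q i (s i) x (y i) - y i)‖ₑ ^ 2 ∂(Measure.pi fun _ => ν)
      ≤ ENNReal.ofReal (‖a‖ ^ 2 + ωQ / n * D ^ 2) := by
  have := completeSpace_tangentSpace (d := d) x
  have hω : 0 ≤ ωQ := (hQ ⟨0, hn⟩).nonneg
  have hvar (i : Fin n) : ∫⁻ s, ‖Q i s x (y i) - y i‖ₑ ^ 2 ∂ν ≤ ENNReal.ofReal (ωQ * D ^ 2) := by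
    grw [(hQ i).variance x (y i), hy i]
  refine (lintegral_enorm_const_add_avg_sq_le (fun i => (hQ i).memLp_sub x (y i))
    (fun i => (hQ i).integral_sub_eq_zero x (y i)) hvar a).trans_eq ?_
  rw [ENNReal.ofReal_add (by positivity) (by positivity), enorm_sq_eq_ofReal, div_mul_eq_mul_div,
    ENNReal.ofReal_div_of_pos (Nat.cast_pos.2 hn), ENNReal.ofReal_natCast]

lemma expectedDensity_pos [IsProbabilityMeasure ν] {n : ℕ} (hd : 0 < d) (hn : 0 < n)
    (b : MeasurableFrame d M)
    {Q : Fin n → S → ∀ x : M, TangentSpace (𝓡 d) x → TangentSpace (𝓡 d) x}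
    (hQ : ∀ i, IsUnbiasedCompressor ν ωQ (Q i)) (x : M) : 0 < expectedDensity b ν Q := by
  have hpos := pos_iff_ne_zero.2
    ((hQ ⟨0, hn⟩).lintegral_nnz_ne_zero b ((b.basis x).ne_zero ⟨0, hd⟩))
  exact ENNReal.ofReal_pos.1 (hpos.trans_le (lintegral_nnz_le b Q ⟨0, hn⟩ x _))

end Compressor

section Objective

variable {d : ℕ} {M : Type*} [TopologicalSpace M] [ChartedSpace (EuclideanSpace ℝ (Fin d)) M]
  {n : ℕ} {f : Fin n → M → ℝ}

lemma mvfderiv_objective (hf : ∀ i, MDifferentiable (𝓡 d) 𝓘(ℝ, ℝ) (f i)) (x : M)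
    (v : TangentSpace (𝓡 d) x) :
    mvfderiv (𝓡 d) (objective f) x v = (n : ℝ)⁻¹ * ∑ i, mvfderiv (𝓡 d) (f i) x v := by
  have hsum := (HasMFDerivAt.sum (t := Finset.univ)
    fun i _ => (hf i x).hasMFDerivAt).const_smul (n : ℝ)⁻¹
  have hobj : objective f = (n : ℝ)⁻¹ • ∑ i, f i := by
    ext x
    simp [objective, div_eq_inv_mul]
  rw [← hobj] at hsum
  refine (congrArg (fun T => T v) hsum.mfderiv).trans ?_
  change ((n : ℝ)⁻¹ • ∑ i, (mvfderiv (𝓡 d) (f i) x : TangentSpace (𝓡 d) x →L[ℝ] ℝ)) v = _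
  rw [smul_apply, sum_apply, smul_eq_mul]

lemma riemGrad_objective [RiemannianBundle (fun x : M => TangentSpace (𝓡 d) x)]
    (hf : ∀ i, MDifferentiable (𝓡 d) 𝓘(ℝ, ℝ) (f i)) (x : M) :
    riemGrad (d := d) (objective f) x = (n : ℝ)⁻¹ • ∑ i, riemGrad (d := d) (f i) x := by
  refine ext_inner_right ℝ fun v => ?_
  rw [inner_riemGrad, mvfderiv_objective hf, real_inner_smul_left, sum_inner]
  simp only [inner_riemGrad]

end Objective

section Round

/-- The law of the randomness of one round; `runLaw` is a power of it. -/
abbrev roundLaw {S : Type*} [MeasurableSpace S] (p : unitInterval) (ν : Measure S) (n : ℕ) :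
    Measure (Round S n) :=
  (bernoulliMeasure true false p).prod (Measure.pi fun _ => ν)

variable {d : ℕ} {M : Type*} [TopologicalSpace M]
  [ChartedSpace (EuclideanSpace ℝ (Fin d)) M] {n : ℕ}

/-- The estimator `g^k = (1/n) ∑ g_i^k` of the gradient. -/
def State.avg (st : State d M n) : TangentSpace (𝓡 d) st.point := (n : ℝ)⁻¹ • ∑ i, st.est i

lemma State.stepVec_eq (η : ℝ) (st : State d M n) : st.stepVec η = -(η • st.avg) := rfl

variable [RiemannianBundle (fun x : M => TangentSpace (𝓡 d) x)] {f : Fin n → M → ℝ} {L ωQ η : ℝ}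

/-- The error `g^k - ∇f(x^k)` of the estimator. -/
def State.err (f : Fin n → M → ℝ) (st : State d M n) : TangentSpace (𝓡 d) st.point :=
  st.avg - riemGrad (objective f) st.point

/-- The state at `x` in which every worker knows its gradient: the initial state, and the one after
a round in which the full gradients are sent. -/
def State.exact (f : Fin n → M → ℝ) (x : M) : State d M n := ⟨x, fun i => riemGrad (f i) x⟩

lemma State.err_exact (hf : ∀ i, MDifferentiable (𝓡 d) 𝓘(ℝ, ℝ) (f i)) (x : M) :
    (State.exact f x : State d M n).err f = 0 := by
  rw [State.err, riemGrad_objective hf, sub_eq_zero]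
  rfl

variable [IsManifold (𝓡 d) ∞ M] {S : Type*}
  {Q : Fin n → S → ∀ x : M, TangentSpace (𝓡 d) x → TangentSpace (𝓡 d) x}

lemma err_step_true (hf : ∀ i, MDifferentiable (𝓡 d) 𝓘(ℝ, ℝ) (f i)) (st : State d M n)
    (s : Fin n → S) : (step f Q η st (true, s)).err f = 0 :=
  State.err_exact hf _

variable [IsContMDiffRiemannianBundle (𝓡 d) 1 (EuclideanSpace ℝ (Fin d))
  (fun x : M => TangentSpace (𝓡 d) x)]

/-- The transport `Γ_{x^k}^{x^{k+1}}` of a step, as a linear isometry. -/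
def State.transportₗᵢ (hM : GeodesicallyComplete d M) (η : ℝ) (st : State d M n) :
    TangentSpace (𝓡 d) st.point →ₗᵢ[ℝ] TangentSpace (𝓡 d) (st.next η) :=
  expTransportₗᵢ hM st.point (st.stepVec η)

lemma State.transport_eq (hM : GeodesicallyComplete d M) (st : State d M n)
    (u : TangentSpace (𝓡 d) st.point) : st.transport η u = st.transportₗᵢ hM η u :=
  expTransport_eq hM _ _ u

lemma State.norm_gradDiff_le (hM : GeodesicallyComplete d M) (hf : ∀ i, IsGSmooth d L (f i))
    (st : State d M n) (i : Fin n) : ‖st.gradDiff f η i‖ ≤ L * ‖st.stepVec η‖ :=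
  (hf i).norm_riemGrad_sub_expTransport_le hM

lemma err_step_false (hM : GeodesicallyComplete d M)
    (hf : ∀ i, MDifferentiable (𝓡 d) 𝓘(ℝ, ℝ) (f i)) (st : State d M n) (s : Fin n → S) :
    ((step f Q η st (false, s)).err f : TangentSpace (𝓡 d) (st.next η))
      = st.transportₗᵢ hM η (st.err f) + (n : ℝ)⁻¹ • ∑ i,
        (Q i (s i) (st.next η) (st.gradDiff f η i) - st.gradDiff f η i) := by
  have hstep : ((step f Q η st (false, s)).err f : TangentSpace (𝓡 d) (st.next η))
      = (n : ℝ)⁻¹ • ∑ i, (st.transport η (st.est i) + Q i (s i) (st.next η) (st.gradDiff f η i))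
        - riemGrad (d := d) (objective f) (st.next η) := rfl
  rw [hstep, State.err, State.avg, riemGrad_objective hf, riemGrad_objective hf, map_sub, map_smul,
    map_smul, map_sum, map_sum, ← smul_sub, ← smul_sub, ← smul_add,
    ← Finset.sum_sub_distrib, ← Finset.sum_sub_distrib, ← Finset.sum_add_distrib]
  congr 1
  refine Finset.sum_congr rfl fun i _ => ?_
  rw [State.gradDiff, State.transport_eq hM, State.transport_eq hM]
  abel

lemma lintegral_err_step_le [MeasurableSpace S] {ν : Measure S} [IsProbabilityMeasure ν]
    (hM : GeodesicallyComplete d M) (hn : 0 < n) (hf : ∀ i, IsGSmooth d L (f i))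
    (hQ : ∀ i, IsUnbiasedCompressor ν ωQ (Q i)) (p : unitInterval) (st : State d M n) :
    ∫⁻ r, ‖(step f Q η st r).err f‖ₑ ^ 2 ∂(roundLaw p ν n)
      ≤ ENNReal.ofReal ((1 - p) * (‖st.err f‖ ^ 2 + ωQ / n * (L * ‖st.stepVec η‖) ^ 2)) := by
  have hdiff (i : Fin n) : MDifferentiable (𝓡 d) 𝓘(ℝ, ℝ) (f i) := (hf i).1
  have htrue : ∫⁻ s, ‖(step f Q η st (true, s)).err f‖ₑ ^ 2 ∂(Measure.pi fun _ => ν) = 0 := by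
    simp only [err_step_true hdiff]
    simp
  have hfalse : ∫⁻ s, ‖(step f Q η st (false, s)).err f‖ₑ ^ 2 ∂(Measure.pi fun _ => ν)
      ≤ ENNReal.ofReal (‖st.err f‖ ^ 2 + ωQ / n * (L * ‖st.stepVec η‖) ^ 2) := by
    have h := lintegral_enorm_const_add_avg_sub_sq_le hn hQ
      (fun i => st.norm_gradDiff_le (η := η) hM hf i) (st.transportₗᵢ hM η (st.err f))
    simp only [← err_step_false hM hdiff] at h
    rwa [LinearIsometry.norm_map] at h
  refine (lintegral_prod_le _).trans ?_
  rw [lintegral_bernoulliMeasure, htrue, mul_zero, zero_add,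
    ENNReal.ofReal_mul (sub_nonneg.2 p.2.2)]
  gcongr

lemma objective_next_le (hM : GeodesicallyComplete d M) (hn : 0 < n)
    (hf : ∀ i, IsGSmooth d L (f i)) (st : State d M n) :
    objective f (st.next η) ≤ objective f st.point
      + inner ℝ (riemGrad (objective f) st.point) (st.stepVec η)
      + L * ‖st.stepVec η‖ ^ 2 / 2 := by
  have hsum := Finset.sum_le_sum (s := Finset.univ) fun i _ =>
    (hf i).riemExp_le (x := st.point) (v := st.stepVec η) hM
  rw [Finset.sum_add_distrib, Finset.sum_add_distrib, Finset.sum_const, Finset.card_univ,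
    Fintype.card_fin, nsmul_eq_mul] at hsum
  rw [riemGrad_objective (fun i => (hf i).1), real_inner_smul_left, sum_inner]
  have hnR : (0 : ℝ) < n := Nat.cast_pos.2 hn
  refine (div_le_div_of_nonneg_right hsum hnR.le).trans_eq ?_
  rw [objective]
  field_simp

end Round

section Stepsize

variable {L η w : ℝ}

lemma mul_stepsize_add_sq_le_one (hL : 0 < L) (hw : 0 ≤ w) (hη : η = 1 / (L * (1 + √w))) :
    L * η + w * (L * η) ^ 2 ≤ 1 := by
  have hB : 0 ≤ √w := Real.sqrt_nonneg w
  have hLη : L * η = 1 / (1 + √w) := by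
    rw [hη]
    field_simp
  rw [hLη, div_pow, mul_div_assoc', div_add_div _ _ (by positivity) (by positivity),
    div_le_one (by positivity)]
  nlinarith [mul_nonneg hB (sq_nonneg (1 + √w)), Real.sq_sqrt hw]

lemma add_potential_le_of_descent {p N G I E F F' : ℝ} (hη : 0 < η) (hp : 0 < p)
    (hcond : L * η + (1 - p) / p * w * (L * η) ^ 2 ≤ 1)
    (hE : E = N ^ 2 - 2 * I + G ^ 2) (hF : F' ≤ F - η * I + L * (η * N) ^ 2 / 2) :
    G ^ 2 + 2 / η * F' + 1 / p * ((1 - p) * (E + w * (L * (η * N)) ^ 2))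
      ≤ 2 / η * F + 1 / p * E := by
  have hdescent : 2 / η * F' ≤ 2 / η * F - 2 * I + L * η * N ^ 2 := by
    calc 2 / η * F' ≤ 2 / η * (F - η * I + L * (η * N) ^ 2 / 2) := by gcongr
      _ = 2 / η * F - 2 * I + L * η * N ^ 2 := by field_simp
  have herror : 1 / p * ((1 - p) * (E + w * (L * (η * N)) ^ 2))
      = 1 / p * E - E + (1 - p) / p * w * (L * η) ^ 2 * N ^ 2 := by
    field_simp
  have hstep : (L * η + (1 - p) / p * w * (L * η) ^ 2) * N ^ 2 ≤ N ^ 2 :=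
    mul_le_of_le_one_left (sq_nonneg N) hcond
  linarith

end Stepsize

section Run

variable {d : ℕ} {M : Type*} [TopologicalSpace M]
  [ChartedSpace (EuclideanSpace ℝ (Fin d)) M] [IsManifold (𝓡 d) ∞ M]
  [RiemannianBundle (fun x : M => TangentSpace (𝓡 d) x)] {S : Type*} {n : ℕ}
  {f : Fin n → M → ℝ} {η : ℝ}
  {Q : Fin n → S → ∀ x : M, TangentSpace (𝓡 d) x → TangentSpace (𝓡 d) x}

lemma iter_eq_runFrom (x0 : M) (k : ℕ) (r : Fin k → Round S n) :
    iter f Q η x0 k r = runFrom (step f Q η) k (State.exact f x0) r := by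
  induction k with
  | zero => rfl
  | succ k ih => rw [iter, ih, runFrom_succ_last]

lemma iterOf_castSucc (x0 : M) {K : ℕ} (r : Fin K → Round S n) (k : Fin K) :
    iterOf f Q η x0 r k.castSucc
      = runFrom (step f Q η) k (State.exact f x0) fun j => r (Fin.castLE k.is_lt.le j) :=
  iter_eq_runFrom x0 _ _

end Run

section Convergence

variable {d : ℕ} {M : Type*} [TopologicalSpace M]
  [ChartedSpace (EuclideanSpace ℝ (Fin d)) M]
  [RiemannianBundle (fun x : M => TangentSpace (𝓡 d) x)] {n : ℕ}
  {f : Fin n → M → ℝ} {L ωQ η fstar : ℝ}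

/-- The Lyapunov function `f(x^k) - f^* + η/(2p) ‖g^k - ∇f(x^k)‖²` of the method, scaled by `2/η`
so that a round decreases it by `‖∇f(x^k)‖²`. -/
def potential (f : Fin n → M → ℝ) (fstar η p : ℝ) (st : State d M n) : ℝ :=
  2 / η * (objective f st.point - fstar) + 1 / p * ‖st.err f‖ ^ 2

lemma potential_exact (hf : ∀ i, MDifferentiable (𝓡 d) 𝓘(ℝ, ℝ) (f i)) (fstar η p : ℝ) (x : M) :
    potential f fstar η p (State.exact f x : State d M n) = 2 / η * (objective f x - fstar) := by
  rw [potential, State.err_exact hf, norm_zero, zero_pow two_ne_zero, mul_zero, add_zero]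
  rfl

variable [IsManifold (𝓡 d) ∞ M] [IsContMDiffRiemannianBundle (𝓡 d) 1 (EuclideanSpace ℝ (Fin d))
  (fun x : M => TangentSpace (𝓡 d) x)] {S : Type*} [MeasurableSpace S] {ν : Measure S}
  [IsProbabilityMeasure ν] {Q : Fin n → S → ∀ x : M, TangentSpace (𝓡 d) x → TangentSpace (𝓡 d) x}

lemma sq_norm_riemGrad_add_le_potential (hM : GeodesicallyComplete d M) (hn : 0 < n)
    (hf : ∀ i, IsGSmooth d L (f i)) {p : ℝ} (hp : 0 < p) (hη : 0 < η)
    (hcond : L * η + (1 - p) / p * (ωQ / n) * (L * η) ^ 2 ≤ 1) (st : State d M n) :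
    ‖riemGrad (d := d) (objective f) st.point‖ ^ 2
        + 2 / η * (objective f (st.next η) - fstar)
        + 1 / p * ((1 - p) * (‖st.err f‖ ^ 2 + ωQ / n * (L * ‖st.stepVec η‖) ^ 2))
      ≤ potential f fstar η p st := by
  have hnorm : ‖st.stepVec η‖ = η * ‖st.avg‖ := by
    rw [st.stepVec_eq, norm_neg, norm_smul, Real.norm_of_nonneg hη.le]
  have hdescent := objective_next_le (η := η) hM hn hf st
  rw [hnorm, st.stepVec_eq, inner_neg_right, real_inner_smul_right] at hdescent
  have herr : ‖st.err f‖ ^ 2 = ‖st.avg‖ ^ 2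
      - 2 * inner ℝ (riemGrad (d := d) (objective f) st.point) st.avg
      + ‖riemGrad (d := d) (objective f) st.point‖ ^ 2 := by
    rw [State.err, norm_sub_sq_real, real_inner_comm]
  rw [hnorm, potential]
  exact add_potential_le_of_descent hη hp hcond herr (by linarith)

lemma lintegral_potential_step_le (hM : GeodesicallyComplete d M) (hn : 0 < n)
    (hf : ∀ i, IsGSmooth d L (f i)) (hstar : ∀ x, fstar ≤ objective f x)
    (hQ : ∀ i, IsUnbiasedCompressor ν ωQ (Q i)) {p : unitInterval} (hp : 0 < (p : ℝ)) (hη : 0 < η)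
    (hcond : L * η + (1 - p) / p * (ωQ / n) * (L * η) ^ 2 ≤ 1) (st : State d M n) :
    ∫⁻ r, (‖riemGrad (d := d) (objective f) st.point‖ₑ ^ 2
        + ENNReal.ofReal (potential f fstar η p (step f Q η st r))) ∂(roundLaw p ν n)
      ≤ ENNReal.ofReal (potential f fstar η p st) := by
  have hω : 0 ≤ ωQ := (hQ ⟨0, hn⟩).nonneg
  have hp1 : (0 : ℝ) ≤ 1 - p := sub_nonneg.2 p.2.2
  have hgap : 0 ≤ 2 / η * (objective f (st.next η) - fstar) :=
    mul_nonneg (by positivity) (sub_nonneg.2 (hstar _))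
  have hsplit (r : Round S n) : ENNReal.ofReal (potential f fstar η p (step f Q η st r))
      = ENNReal.ofReal (2 / η * (objective f (st.next η) - fstar))
        + ENNReal.ofReal (1 / p) * ‖(step f Q η st r).err f‖ₑ ^ 2 := by
    rw [enorm_sq_eq_ofReal, ← ENNReal.ofReal_mul (by positivity),
      ← ENNReal.ofReal_add hgap (by positivity)]
    rfl
  simp only [hsplit]
  rw [lintegral_add_left measurable_const, lintegral_add_left measurable_const,
    lintegral_const_mul' _ _ ENNReal.ofReal_ne_top, lintegral_const, lintegral_const, measure_univ,
    mul_one, mul_one]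
  grw [lintegral_err_step_le hM hn hf hQ p st]
  rw [enorm_sq_eq_ofReal, ← ENNReal.ofReal_mul (by positivity),
    ← ENNReal.ofReal_add hgap (by positivity),
    ← ENNReal.ofReal_add (by positivity) (by positivity), ← add_assoc]
  exact ENNReal.ofReal_le_ofReal (sq_norm_riemGrad_add_le_potential hM hn hf hp hη hcond st)

lemma expectedSqGrad_le (hM : GeodesicallyComplete d M) (hn : 0 < n)
    (hf : ∀ i, IsGSmooth d L (f i)) (hstar : ∀ x, fstar ≤ objective f x)
    (hQ : ∀ i, IsUnbiasedCompressor ν ωQ (Q i)) {p : unitInterval} (hp : 0 < (p : ℝ)) (hη : 0 < η)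
    (hcond : L * η + (1 - p) / p * (ωQ / n) * (L * η) ^ 2 ≤ 1) (x0 : M) {K : ℕ} (hK : 0 < K) :
    expectedSqGrad f Q η x0 p ν K ≤ ENNReal.ofReal (2 / η * (objective f x0 - fstar) / K) := by
  have : NeZero K := ⟨hK.ne'⟩
  rw [div_eq_inv_mul, ENNReal.ofReal_mul (by positivity), ENNReal.ofReal_inv_of_pos
    (Nat.cast_pos.2 hK), ENNReal.ofReal_natCast,
    ← potential_exact (p := p) fun i => (hf i).1]
  have hiter (r : Fin K → Round S n) (k : Fin K) :
      ‖riemGrad (d := d) (objective f) (iterOf f Q η x0 r k.castSucc).point‖ₑ ^ 2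
        = ‖riemGrad (d := d) (objective f) (runFrom (step f Q η) k (State.exact f x0)
          fun j => r (Fin.castLE k.is_lt.le j)).point‖ₑ ^ 2 := by
    rw [iterOf_castSucc]
  refine (lintegral_prod_le _).trans ?_
  simp only [lintegral_uniformOn_univ, Fintype.card_fin, hiter]
  rw [lintegral_const_mul' _ _ (by simp [hK.ne'])]
  gcongr
  exact lintegral_sum_runFrom_le (roundLaw p ν n) (step f Q η)
    (fun st _ => ‖riemGrad (d := d) (objective f) st.point‖ₑ ^ 2)
    (fun _ st => ENNReal.ofReal (potential f fstar η p st))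
    (fun _ st => lintegral_potential_step_le hM hn hf hstar hQ hp hη hcond st) K _

end Convergence

section Communication

variable {d : ℕ} {M : Type*} [TopologicalSpace M]
  [ChartedSpace (EuclideanSpace ℝ (Fin d)) M] [IsManifold (𝓡 d) ∞ M]
  [RiemannianBundle (fun x : M => TangentSpace (𝓡 d) x)] {S : Type*} {n : ℕ}

/-- The number of components that worker `i` sends in one round. -/
def roundCost (b : MeasurableFrame d M) (f : Fin n → M → ℝ)
    (Q : Fin n → S → ∀ x : M, TangentSpace (𝓡 d) x → TangentSpace (𝓡 d) x) (η : ℝ) (i : Fin n)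
    (st : State d M n) (r : Round S n) : ℕ :=
  if r.1 then d else b.nnz (Q i (r.2 i) _ (st.gradDiff f η i))

variable [MeasurableSpace S] {ν : Measure S} [IsProbabilityMeasure ν]
  (b : MeasurableFrame d M) (f : Fin n → M → ℝ)
  (Q : Fin n → S → ∀ x : M, TangentSpace (𝓡 d) x → TangentSpace (𝓡 d) x) (η : ℝ)

lemma lintegral_roundCost_le (hd : 0 < d) {p : unitInterval}
    (hp : (p : ℝ) = expectedDensity b ν Q / d) (i : Fin n) (st : State d M n) :
    ∫⁻ r, (roundCost b f Q η i st r : ℝ≥0∞) ∂(roundLaw p ν n)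
      ≤ ENNReal.ofReal (2 * expectedDensity b ν Q) := by
  have hρ : 0 ≤ expectedDensity b ν Q := ENNReal.toReal_nonneg
  have hcoin : ENNReal.ofReal p * d = ENNReal.ofReal (expectedDensity b ν Q) := by
    rw [← ENNReal.ofReal_natCast d, ← ENNReal.ofReal_mul p.2.1, hp,
      div_mul_cancel₀ _ (Nat.cast_ne_zero.2 hd.ne')]
  have hfull : ∫⁻ s : Fin n → S, (roundCost b f Q η i st (true, s) : ℝ≥0∞)
      ∂(Measure.pi fun _ => ν) = d := by
    simp [roundCost]
  have hcompressed : ∫⁻ s : Fin n → S, (roundCost b f Q η i st (false, s) : ℝ≥0∞)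
      ∂(Measure.pi fun _ => ν) ≤ ENNReal.ofReal (expectedDensity b ν Q) :=
    (lintegral_pi_eval_le (fun _ => ν) i fun s =>
      (b.nnz (Q i s _ (st.gradDiff f η i)) : ℝ≥0∞)).trans (lintegral_nnz_le b Q i _ _)
  have hp1 : ENNReal.ofReal (1 - p) ≤ 1 := ENNReal.ofReal_le_one.2 (sub_le_self _ p.2.1)
  refine (lintegral_prod_le _).trans ?_
  rw [lintegral_bernoulliMeasure, hfull, hcoin]
  grw [hcompressed, hp1]
  rw [one_mul, two_mul, ENNReal.ofReal_add hρ hρ]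

lemma lintegral_commCost_le (hd : 0 < d) {p : unitInterval}
    (hp : (p : ℝ) = expectedDensity b ν Q / d) (x0 : M) (K : ℕ) (i : Fin n) :
    ∫⁻ r, (commCost b f Q η x0 i r : ℝ≥0∞) ∂(runLaw p ν n K)
      ≤ ENNReal.ofReal (d + K * (2 * expectedDensity b ν Q)) := by
  have hρ : 0 ≤ 2 * expectedDensity b ν Q := mul_nonneg zero_le_two ENNReal.toReal_nonneg
  have hlaw : IsProbabilityMeasure (runLaw p ν n K) :=
    inferInstanceAs (IsProbabilityMeasure (Measure.pi fun _ => roundLaw p ν n))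
  have hcost (r : Fin K → Round S n) : (commCost b f Q η x0 i r : ℝ≥0∞)
      = d + ∑ k : Fin K, (roundCost b f Q η i (runFrom (step f Q η) k (State.exact f x0)
        fun j => r (Fin.castLE k.is_lt.le j)) (r k) : ℝ≥0∞) := by
    simp only [← iterOf_castSucc, commCost, Nat.cast_add, Nat.cast_sum]
    rfl
  have hround (K : ℕ) (st : State d M n) : ∫⁻ r, ((roundCost b f Q η i st r : ℝ≥0∞)
      + K * ENNReal.ofReal (2 * expectedDensity b ν Q)) ∂(roundLaw p ν n)
      ≤ (K + 1 : ℕ) * ENNReal.ofReal (2 * expectedDensity b ν Q) := by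
    rw [lintegral_add_right _ measurable_const, lintegral_const, measure_univ, mul_one]
    grw [lintegral_roundCost_le b f Q η hd hp i st]
    rw [Nat.cast_succ, add_one_mul, add_comm]
  simp only [hcost]
  rw [lintegral_add_left measurable_const, lintegral_const, measure_univ, mul_one,
    ENNReal.ofReal_add (by positivity) (by positivity), ENNReal.ofReal_mul (by positivity),
    ENNReal.ofReal_natCast, ENNReal.ofReal_natCast]
  gcongr
  exact lintegral_sum_runFrom_le (roundLaw p ν n) (step f Q η) _
    (fun K _ => K * ENNReal.ofReal (2 * expectedDensity b ν Q)) hround K _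

end Communication

lemma exists_nat_ge_and_le_max (X : ℝ) :
    ∃ K₀ : ℕ, 1 ≤ K₀ ∧ (K₀ : ℝ) ≤ max 1 (2 * X) ∧ X ≤ K₀ := by
  rcases le_or_gt X 1 with h | h
  · exact ⟨1, le_rfl, by simp, by simpa using h⟩
  · refine ⟨⌈X⌉₊, Nat.one_le_ceil_iff.2 (by linarith), le_max_of_le_right ?_, Nat.le_ceil X⟩
    linarith [Nat.ceil_lt_add_one (a := X) (by linarith)]

end RMarina

end

theorem corollary11_general {d n : ℕ} (hd : 0 < d) (hn : 0 < n)
    {M : Type*} [TopologicalSpace M] [ChartedSpace (EuclideanSpace ℝ (Fin d)) M]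
    [IsManifold (𝓡 d) ∞ M] [RiemannianBundle (fun x : M => TangentSpace (𝓡 d) x)]
    [IsContMDiffRiemannianBundle (𝓡 d) 1 (EuclideanSpace ℝ (Fin d))
      (fun x : M => TangentSpace (𝓡 d) x)]
    (hM : RMarina.GeodesicallyComplete d M)
    {f : Fin n → M → ℝ} {L : ℝ} (hL : 0 < L) (hf : ∀ i, RMarina.IsGSmooth d L (f i))
    {fstar : ℝ} (hstar : ∀ x, fstar ≤ RMarina.objective f x) (x0 : M)
    {S : Type*} [MeasurableSpace S] {ν : Measure S} [IsProbabilityMeasure ν]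
    {Q : Fin n → S → ∀ x : M, TangentSpace (𝓡 d) x → TangentSpace (𝓡 d) x}
    {ωQ : ℝ} (hQ : ∀ i, RMarina.IsUnbiasedCompressor ν ωQ (Q i))
    (b : RMarina.MeasurableFrame d M)
    {ρ : ℝ} (hρ : ρ = RMarina.expectedDensity b ν Q) {p : unitInterval} (hp : (p : ℝ) = ρ / d)
    {η : ℝ} (hη : η = 1 / (L * (1 + √((1 - p) / p * (ωQ / n))))) {ε : ℝ} (hε : 0 < ε) :
    (∃ K₀ : ℕ, 1 ≤ K₀ ∧
      (K₀ : ℝ) ≤ max 1 (4 * ((RMarina.objective f x0 - fstar) * L / ε ^ 2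
        * (1 + √(ωQ / n * (d / ρ - 1))))) ∧
      ∀ K : ℕ, K₀ ≤ K →
        RMarina.expectedSqGrad f Q η x0 p ν K ≤ ENNReal.ofReal (ε ^ 2)) ∧
    ∀ (K : ℕ) (i : Fin n),
      ∫⁻ r, (RMarina.commCost b f Q η x0 i r : ℝ≥0∞) ∂(RMarina.runLaw p ν n K)
        ≤ ENNReal.ofReal (4 * (d + ρ * K)) := by
  have hρ0 : 0 < ρ := hρ ▸ RMarina.expectedDensity_pos hd hn b hQ x0
  have hp0 : 0 < (p : ℝ) := by rw [hp]; positivity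
  have hω : 0 ≤ ωQ := (hQ ⟨0, hn⟩).nonneg
  have hp1 : (0 : ℝ) ≤ 1 - p := sub_nonneg.2 p.2.2
  have hw : (1 - p) / p * (ωQ / n) = ωQ / n * (d / ρ - 1) := by rw [hp]; field_simp
  have hη0 : 0 < η := by rw [hη]; positivity
  have hcond := RMarina.mul_stepsize_add_sq_le_one hL (by positivity) hη
  refine ⟨?_, fun K i => ?_⟩
  · obtain ⟨K₀, hK₀, hle, hge⟩ := RMarina.exists_nat_ge_and_le_max
      (2 / η * (RMarina.objective f x0 - fstar) / ε ^ 2)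
    refine ⟨K₀, hK₀, hle.trans_eq ?_, fun K hK => ?_⟩
    · rw [← hw, hη]
      field_simp
      ring_nf
    · have hK0 : 0 < K := hK₀.trans hK
      refine (RMarina.expectedSqGrad_le hM hn hf hstar hQ hp0 hη0 hcond x0 hK0).trans
        (ENNReal.ofReal_le_ofReal ?_)
      rw [div_le_comm₀ (by positivity) (by positivity)]
      exact hge.trans (Nat.cast_le.2 hK)
  · refine (RMarina.lintegral_commCost_le b f Q η hd (hρ ▸ hp) x0 K i).trans
      (ENNReal.ofReal_le_ofReal ?_)
    rw [← hρ]
    nlinarith [Nat.cast_nonneg (α := ℝ) d, mul_nonneg hρ0.le (Nat.cast_nonneg (α := ℝ) K)]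

theorem corollary11 :
    ∃ C : ℝ, 0 < C ∧
      ∀ (d n : ℕ) (_ : 0 < d) (_ : 0 < n)
        (M : Type*) [TopologicalSpace M] [T2Space M] [SecondCountableTopology M]
        [ChartedSpace (EuclideanSpace ℝ (Fin d)) M] [IsManifold (𝓡 d) ∞ M]
        [RiemannianBundle (fun x : M => TangentSpace (𝓡 d) x)]
        [IsContMDiffRiemannianBundle (𝓡 d) ∞ (EuclideanSpace ℝ (Fin d))
          (fun x : M => TangentSpace (𝓡 d) x)]
        (_ : RMarina.GeodesicallyComplete d M)
        -- the functions `f_i`, a lower bound `f^*` of `f`, the starting point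
        (f : Fin n → M → ℝ) (L : ℝ) (_ : 0 < L) (_ : ∀ i, RMarina.IsGSmooth d L (f i))
        (fstar : ℝ) (_ : ∀ x, fstar ≤ RMarina.objective f x) (x0 : M)
        -- the compressors
        (S : Type*) [MeasurableSpace S] (ν : Measure S) [IsProbabilityMeasure ν]
        (Q : Fin n → S → ∀ x : M, TangentSpace (𝓡 d) x → TangentSpace (𝓡 d) x)
        (ωQ : ℝ) (_ : ∀ i, RMarina.IsUnbiasedCompressor ν ωQ (Q i))
        (b : RMarina.MeasurableFrame d M)
        -- the parameters of the method
        (ρ : ℝ) (_ : ρ = RMarina.expectedDensity b ν Q)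
        (p : unitInterval) (_ : (p : ℝ) = ρ / d)
        (η : ℝ) (_ : η = 1 / (L * (1 + √((1 - p) / p * (ωQ / n)))))
        (ε : ℝ) (_ : 0 < ε),
        (∃ K₀ : ℕ, 1 ≤ K₀ ∧
          (K₀ : ℝ) ≤ max 1 (C * ((RMarina.objective f x0 - fstar) * L / ε ^ 2
            * (1 + √(ωQ / n * (d / ρ - 1))))) ∧
          ∀ K : ℕ, K₀ ≤ K →
            RMarina.expectedSqGrad f Q η x0 p ν K ≤ ENNReal.ofReal (ε ^ 2)) ∧
        ∀ (K : ℕ) (i : Fin n),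
          ∫⁻ r, (RMarina.commCost b f Q η x0 i r : ℝ≥0∞) ∂(RMarina.runLaw p ν n K)
            ≤ ENNReal.ofReal (C * (d + ρ * K)) := by
  refine ⟨4, four_pos, fun d n hd hn M _ _ _ _ _ _ _ hM _ _ hL hf _ hstar x0 _ _ _ _ _ _ hQ b _ hρ
    _ hp _ hη _ hε => ?_⟩
  have : IsContMDiffRiemannianBundle (𝓡 d) 1 (EuclideanSpace ℝ (Fin d))
      (fun x : M => TangentSpace (𝓡 d) x) := .of_le (n := ∞) (mod_cast le_top)
  exact corollary11_general hd hn hM hL hf hstar x0 hQ b hρ hp hη hε
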